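/- Let $\xi_j$ ($j\in\mathbb Z$) be random points in $\mathbb R^d$ such that $\sum_{j\in\mathbb Z}\delta_{\xi_j}$ is a homogeneous Poisson process of rate $\lambda\in(0,\infty)$, let $\{Y_t,t\ge 0\}$ be a random process in $\mathbb R^d$ with $Y_0=0$, and let $\{Y^{(j)}_t,t\ge0\}$, $j\in\mathbb Z$, be independent copies of it, the family $(Y^{(j)})_j$ being independent of $(\xi_j)_j$. Let $B\subset\mathbb R^d$ be a compact set with non-empty interior, and let $$N(t)=\sum_{j\in\mathbb Z}\mathbf 1\{\xi_j+Y^{(j)}_t\in B\},\qquad t\ge 0,$$ be the associated Smoluchowski process; assume that it is (jointly) measurable and strictly stationary. Put $\rho=\lambda\,\mathrm{vol}(B)$, $B(x)=\{z-x: z\in B\}$, $$U(t_1,\dots,t_k)=\frac1{\mathrm{vol}(B)}\,\mathbb E\,\mathrm{vol}\Big(\bigcap_{i=1}^k B(Y_{t_i})\Big),\qquad H(t)=H(-t)=\frac1{\mathrm{vol}(B)}\,\mathbb E\,\mathrm{vol}\big(B\cap B(Y_t)\big)\quad(t\ge0),$$ $R(t)=\mathrm{cov}\{N(0),N(t)\}$,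 and, for $0\le t<T$, $$\hat R(t)=\frac1{T-t}\int_0^{T-t}(N(u)-\rho)(N(t+u)-\rho)\,du .$$ Then all the integrals and expectations below exist (the path integral defining $\hat R(t)$ almost surely, and $\hat R(t)-R(t)$ is square integrable), and for all $0\le t<T$ and $0\le s<T$ $$\begin{aligned}(T-s)(T-t)\,\mathbb E\big[(\hat R(t)-R(t))(\hat R(s)-R(s))\big] ={}&\rho^2\int_0^{T-s}\!\!\int_0^{T-t}\big[H(\tau_1-\tau_2)H(\tau_1-\tau_2+t-s)+H(\tau_1-\tau_2-s)H(\tau_1-\tau_2+t)\big]\,d\tau_1\,d\tau_2\\ &+\rho\int_0^{T-s}\!\!\int_0^{T-t}U(\tau_1,\tau_1+t,\tau_2,\tau_2+s)\,d\tau_1\,d\tau_2 .\end{aligned}$$ In particular, there is an absolute constant $C$ such that for all $0\le t<T$ $$\mathbb E|\hat R(t)-R(t)|^2\le\frac{C(\rho^2+\rho)}{T-t}\int_0^T H(y)\,dy .$$ -/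

import Mathlib

open MeasureTheory ProbabilityTheory
open scoped NNReal ENNReal

namespace Smoluchowski

noncomputable section

/-- The translate `B(x) = {z - x : z ∈ B}`. -/
def shift {d : ℕ} (B : Set (EuclideanSpace ℝ (Fin d))) (x : EuclideanSpace ℝ (Fin d)) :
    Set (EuclideanSpace ℝ (Fin d)) :=
  {y | ∃ z ∈ B, y = z - x}

/-- The point process `Ξ = ∑ⱼ ε_{ξⱼ}`, a random measure. -/
def pointProcess {d : ℕ} {Ω : Type*} (ξ : ℤ → Ω → EuclideanSpace ℝ (Fin d)) (ω : Ω) :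
    Measure (EuclideanSpace ℝ (Fin d)) :=
  Measure.sum fun j => Measure.dirac (ξ j ω)

/-- `Ξ = ∑ⱼ ε_{ξⱼ}` is a homogeneous Poisson process of rate `lam` on `ℝᵈ`: the number of points in
a Borel set of finite volume is Poisson distributed with mean `lam * vol A`, and the numbers of
points in disjoint sets are independent. -/
structure IsHomogeneousPoisson {d : ℕ} {Ω : Type*} [MeasurableSpace Ω] (P : Measure Ω)
    (lam : ℝ≥0) (ξ : ℤ → Ω → EuclideanSpace ℝ (Fin d)) : Prop where
  measurable : ∀ j, Measurable (ξ j)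
  hasLaw : ∀ A : Set (EuclideanSpace ℝ (Fin d)), MeasurableSet A → volume A ≠ ∞ →
    HasLaw (fun ω => pointProcess ξ ω A)
      ((poissonMeasure (lam * (volume A).toNNReal)).map (fun n : ℕ => (n : ℝ≥0∞))) P
  indep : ∀ (n : ℕ) (A : Fin n → Set (EuclideanSpace ℝ (Fin d))),
    (∀ i, MeasurableSet (A i)) → (∀ i, volume (A i) ≠ ∞) →
    Pairwise (fun i j => Disjoint (A i) (A j)) →
    iIndepFun (fun i ω => pointProcess ξ ω (A i)) P

/-- The system of moving particles: initial positions `ξⱼ` forming a homogeneous Poisson process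
of rate `lam`, and displacement processes `Yp j`, which are independent copies of the generic
displacement process `Y` (living on `Ω'`, with `Y 0 = 0`) and independent of the initial
positions. -/
structure IsParticleSystem {d : ℕ} {Ω Ω' : Type*} [MeasurableSpace Ω] [MeasurableSpace Ω']
    (P : Measure Ω) (P' : Measure Ω') (lam : ℝ≥0)
    (Y : ℝ≥0 → Ω' → EuclideanSpace ℝ (Fin d))
    (ξ : ℤ → Ω → EuclideanSpace ℝ (Fin d))
    (Yp : ℤ → ℝ≥0 → Ω → EuclideanSpace ℝ (Fin d)) : Prop where
  poisson : IsHomogeneousPoisson P lam ξ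
  measurable_generic : ∀ t, Measurable (Y t)
  generic_zero : ∀ᵐ ω ∂P', Y 0 ω = 0
  measurable_copy : ∀ j t, Measurable (Yp j t)
  identDistrib : ∀ j, IdentDistrib (fun ω t => Yp j t ω) (fun ω t => Y t ω) P P'
  iIndep_copies : iIndepFun (fun j ω t => Yp j t ω) P
  indep_initial : IndepFun (fun ω j => ξ j ω) (fun ω j t => Yp j t ω) P

/-- The Smoluchowski process `N(t) = ∑ⱼ 1{ξⱼ + Yⱼ(t) ∈ B}`. -/
def N {d : ℕ} {Ω : Type*} (B : Set (EuclideanSpace ℝ (Fin d)))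
    (ξ : ℤ → Ω → EuclideanSpace ℝ (Fin d))
    (Yp : ℤ → ℝ≥0 → Ω → EuclideanSpace ℝ (Fin d)) (t : ℝ≥0) (ω : Ω) : ℝ :=
  (∑' j : ℤ, B.indicator (fun _ => (1 : ℝ≥0∞)) (ξ j ω + Yp j t ω)).toReal

/-- Strict stationarity of a process on `[0, ∞)`: its finite dimensional distributions are
invariant under time shifts. -/
def IsStrictlyStationary {Ω : Type*} [MeasurableSpace Ω] (P : Measure Ω)
    (Z : ℝ≥0 → Ω → ℝ) : Prop :=
  ∀ (n : ℕ) (t : Fin n → ℝ≥0) (τ : ℝ≥0),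
    IdentDistrib (fun ω i => Z (t i + τ) ω) (fun ω i => Z (t i) ω) P P

/-- `ρ = lam * vol B`, the mean of `N(t)`. -/
def rho {d : ℕ} (lam : ℝ≥0) (B : Set (EuclideanSpace ℝ (Fin d))) : ℝ :=
  lam * volume.real B

/-- `U(t₁, …, tₖ) = E vol(B(Y_{t₁}) ∩ … ∩ B(Y_{tₖ})) / vol B`. -/
def U {d : ℕ} {Ω' : Type*} [MeasurableSpace Ω'] (P' : Measure Ω')
    (B : Set (EuclideanSpace ℝ (Fin d))) (Y : ℝ≥0 → Ω' → EuclideanSpace ℝ (Fin d))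
    {k : ℕ} (t : Fin k → ℝ≥0) : ℝ :=
  (1 / volume.real B) * ∫ ω, volume.real (⋂ i, shift B (Y (t i) ω)) ∂P'

/-- `H(t) = E vol(B ∩ B(Y_t)) / vol B` for `t ≥ 0`, extended to the real line by
`H(-t) = H(t)`. -/
def H {d : ℕ} {Ω' : Type*} [MeasurableSpace Ω'] (P' : Measure Ω')
    (B : Set (EuclideanSpace ℝ (Fin d))) (Y : ℝ≥0 → Ω' → EuclideanSpace ℝ (Fin d))
    (t : ℝ) : ℝ :=
  (1 / volume.real B) * ∫ ω, volume.real (B ∩ shift B (Y (Real.nnabs t) ω)) ∂P'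

/-- The covariance function `R(t) = cov(Z(0), Z(t))` of a stationary process `Z` on `[0, ∞)`, at a
lag `t ≥ 0`. -/
def R {Ω : Type*} [MeasurableSpace Ω] (P : Measure Ω) (Z : ℝ≥0 → Ω → ℝ) (t : ℝ) : ℝ :=
  cov[Z 0, Z t.toNNReal; P]

/-- The integrand `(Z(u) - m) (Z(t + u) - m)` of the empirical covariance (`u, t ≥ 0`). -/
def empIntegrand {Ω : Type*} (Z : ℝ≥0 → Ω → ℝ) (m t : ℝ) (ω : Ω) (u : ℝ) : ℝ :=
  (Z u.toNNReal ω - m) * (Z (t + u).toNNReal ω - m)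

/-- The empirical covariance
`R̂(t) = (T - t)⁻¹ ∫₀^{T-t} (Z(u) - m) (Z(t + u) - m) du`, for `0 ≤ t < T`. -/
def Rhat {Ω : Type*} (Z : ℝ≥0 → Ω → ℝ) (m T t : ℝ) (ω : Ω) : ℝ :=
  (1 / (T - t)) * ∫ u in (0 : ℝ)..(T - t), empIntegrand Z m t ω u

end

end Smoluchowski

open Smoluchowski

namespace Smoluchowski

/-! The pairs of a starting point and a displacement path form a marked Poisson process, whose
intensity is `lam` times volume times the law of `Y`, and `N(t)` counts its points with `ξ + Y_t ∈
B`. Factorial moments of a Poisson process are products. Hence `E ∏ N(tᵢ)` is a sum over set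
partitions of the times, a block contributing `ρ U(block)`. A singleton block contributes `ρ`, and
centering at `ρ` removes every partition that has one. So the second central moment is `ρ U(s,t)`,
and the fourth is `ρ²` times the sum over the three pairings, plus `ρ U` of all four times
(`integral_centered_mul_four`).

Stationarity turns `U(a,b)` into `H(a-b)`, so `R(t) = ρ H(t)`. One of the three pairings cancels
against `R(t) R(s)`; the other two and the four-point term are the integrand of the theorem, and
Fubini integrates it over the rectangle. For the bound, `0 ≤ H ≤ 1`, the four-point `U` is at most a
two-point one, and integrating `H(τ₁-τ₂+c)` along one variable gives at most the integral of `H`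
over `[-T,T]`.

The hypotheses speak only of counts of a labelled family `ξ`. The product form of the factorial
moments (`factorialMeasure_eq_pi`) is derived from them: boxes with disjoint sides are handled by
independence, diagonals by simplicity of the process. -/

/-! ### Products of sums as sums over tuples of distinct indices. -/

/-- The sum of `∏ i, a i (e i)` over all `k`-tuples `e` of pairwise distinct indices. -/
noncomputable def distinctSum {ι : Type*} {k : ℕ} (a : Fin k → ι → ℝ≥0∞) : ℝ≥0∞ :=
  ∑' e : Fin k ↪ ι, ∏ i, a i (e i)

theorem tsum_eq_sum_embedding_add {ι : Type*} {k : ℕ} (d : ι → ℝ≥0∞) (e : Fin k ↪ ι) :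
    ∑' j, d j = ∑ i, d (e i) + ∑' l : {l // l ∉ Set.range e}, d l := by
  have h := (ENNReal.summable (f := fun j : Set.range e => d j)).tsum_add_tsum_compl
    (f := d) (s := Set.range e) ENNReal.summable
  rw [← h]
  congr 1
  rw [← (Equiv.ofInjective e e.injective).tsum_eq, tsum_fintype]
  rfl

/-- A new index either differs from all indices of the tuple, or equals exactly one of them, whose
factor then absorbs `d`. Iterating this step enumerates set partitions. -/
theorem tsum_mul_distinctSum {ι : Type*} {k : ℕ} (d : ι → ℝ≥0∞) (a : Fin k → ι → ℝ≥0∞) :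
    (∑' j, d j) * distinctSum a =
      distinctSum (Fin.cons d a : Fin (k + 1) → ι → ℝ≥0∞) +
        ∑ i, distinctSum (Function.update a i (d * a i)) := by
  have h1 : distinctSum (Fin.cons d a : Fin (k + 1) → ι → ℝ≥0∞) =
      ∑' e : Fin k ↪ ι, ∑' l : {l // l ∉ Set.range e}, d l * ∏ i, a i (e i) := by
    unfold distinctSum
    rw [← (Equiv.embeddingFinSucc k ι).symm.tsum_eq, ENNReal.tsum_sigma']
    refine tsum_congr fun e => tsum_congr fun l => ?_
    rw [Equiv.coe_embeddingFinSucc_symm, Fin.prod_univ_succ]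
    simp
  have h2 : ∀ i, distinctSum (Function.update a i (d * a i)) =
      ∑' e : Fin k ↪ ι, d (e i) * ∏ l, a l (e l) := by
    intro i
    refine tsum_congr fun e => ?_
    have : ∀ l, Function.update a i (d * a i) l (e l) =
        (if l = i then d (e l) else 1) * a l (e l) := by
      intro l
      by_cases hl : l = i
      · subst hl; simp
      · simp [hl]
    simp_rw [this, Finset.prod_mul_distrib]
    simp
  simp_rw [h1, h2]
  rw [← Summable.tsum_finsetSum fun _ _ => ENNReal.summable, ← ENNReal.tsum_add, distinctSum,
    ← ENNReal.tsum_mul_left]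
  refine tsum_congr fun e => ?_
  rw [tsum_eq_sum_embedding_add d e, add_mul, Finset.sum_mul, ENNReal.tsum_mul_right, add_comm]

@[simp]
theorem distinctSum_of_isEmpty {ι : Type*} (a : Fin 0 → ι → ℝ≥0∞) : distinctSum a = 1 := by
  simp [distinctSum]

theorem distinctSum_singleton {ι : Type*} (f : ι → ℝ≥0∞) : distinctSum ![f] = ∑' j, f j := by
  have := tsum_mul_distinctSum f ![]
  simpa [eq_comm] using this

theorem distinctSum_eq_zero {ι : Type*} {k : ℕ} (a : Fin k → ι → ℝ≥0∞) {i : Fin k}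
    (h : a i = 0) : distinctSum a = 0 := by
  simp only [distinctSum, ENNReal.tsum_eq_zero]
  exact fun e => Finset.prod_eq_zero (Finset.mem_univ i) (by simp [h])

/-- For disjoint supports a tuple with a repeated index contributes zero, so distinctness is no
restriction. -/
theorem distinctSum_eq_prod {ι : Type*} {k : ℕ} (a : Fin k → ι → ℝ≥0∞)
    (h : Pairwise fun i j => a i * a j = 0) : distinctSum a = ∏ i, ∑' j, a i j := by
  induction k with
  | zero => simp
  | succ k ih =>
    have h1 := tsum_mul_distinctSum (a 0) (Fin.tail a)
    rw [Finset.sum_eq_zero, add_zero, Fin.cons_self_tail, ih] at h1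
    · rw [← h1, Fin.prod_univ_succ]; rfl
    · exact fun i j hij => h fun hs => hij (Fin.succ_injective _ hs)
    · intro i _
      refine distinctSum_eq_zero _ (i := i) ?_
      rw [Function.update_self]
      exact h (Fin.succ_ne_zero i).symm

theorem tsum_mul_tsum {ι : Type*} (f g : ι → ℝ≥0∞) :
    (∑' j, f j) * ∑' j, g j = distinctSum ![f, g] + distinctSum ![f * g] := by
  rw [← distinctSum_singleton g, tsum_mul_distinctSum, Fin.sum_univ_one]
  congr 3
  ext i
  fin_cases i
  rfl

theorem tsum_mul_distinctSum_two {ι : Type*} (f g h : ι → ℝ≥0∞) :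
    (∑' j, f j) * distinctSum ![g, h] =
      distinctSum ![f, g, h] + distinctSum ![f * g, h] + distinctSum ![g, f * h] := by
  rw [tsum_mul_distinctSum, Fin.sum_univ_two, ← add_assoc]
  congr 3 <;> ext i <;> fin_cases i <;> rfl

theorem tsum_mul_distinctSum_three {ι : Type*} (f g h l : ι → ℝ≥0∞) :
    (∑' j, f j) * distinctSum ![g, h, l] =
      distinctSum ![f, g, h, l] + distinctSum ![f * g, h, l] + distinctSum ![g, f * h, l] +
        distinctSum ![g, h, f * l] := by
  rw [tsum_mul_distinctSum, Fin.sum_univ_three, ← add_assoc, ← add_assoc]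
  congr 3 <;> ext i <;> fin_cases i <;> rfl

/-! ### Product integrals and estimates for the Poisson law. -/

theorem lintegral_pi_prod_eq_prod {α : Type*} [MeasurableSpace α] (μ : Measure α) [SigmaFinite μ]
    {k : ℕ} (f : Fin k → α → ℝ≥0∞) (hf : ∀ i, Measurable (f i)) :
    ∫⁻ x, ∏ i, f i (x i) ∂Measure.pi (fun _ : Fin k => μ) = ∏ i, ∫⁻ x, f i x ∂μ := by
  induction k with
  | zero => simp
  | succ k ih =>
    rw [Fin.prod_univ_succ, ← ih (fun i => f i.succ) fun i => hf _,
      ← ((measurePreserving_piFinSuccAbove (fun _ : Fin (k + 1) => μ) 0).symm).lintegral_comp_emb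
        (MeasurableEquiv.measurableEmbedding _)]
    rw [← lintegral_prod_mul (hf 0).aemeasurable
      (Finset.measurable_fun_prod _ fun i _ =>
        (hf i.succ).comp (measurable_pi_apply i)).aemeasurable]
    refine lintegral_congr fun x => ?_
    rw [Fin.prod_univ_succ]
    simp [MeasurableEquiv.piFinSuccAbove]

theorem pointProcess_apply {d : ℕ} {Ω : Type*} (ξ : ℤ → Ω → EuclideanSpace ℝ (Fin d)) (ω : Ω)
    {A : Set (EuclideanSpace ℝ (Fin d))} (hA : MeasurableSet A) :
    pointProcess ξ ω A = ∑' j, A.indicator 1 (ξ j ω) := by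
  rw [pointProcess, Measure.sum_apply _ hA]
  exact tsum_congr fun j => Measure.dirac_apply' _ hA

theorem lintegral_natCast_poissonMeasure (r : ℝ≥0) :
    ∫⁻ n : ℕ, (n : ℝ≥0∞) ∂poissonMeasure r = r := by
  rw [lintegral_countable']
  simp_rw [poissonMeasure_singleton]
  rw [tsum_eq_zero_add' ENNReal.summable]
  -- Size biasing: `(n+1) p(n+1) = r p(n)`, so the mean is `r` times the total mass.
  have h : ∀ n : ℕ, ((n + 1 : ℕ) : ℝ≥0∞) *
      ENNReal.ofReal (Real.exp (-r) * r ^ (n + 1) / (n + 1).factorial) =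
      r * poissonMeasure r {n} := by
    intro n
    rw [poissonMeasure_singleton, ← ENNReal.ofReal_natCast, ← ENNReal.ofReal_coe_nnreal,
      ← ENNReal.ofReal_mul (by positivity), ← ENNReal.ofReal_mul (by positivity)]
    congr 1
    rw [Nat.factorial_succ]
    push_cast
    field_simp
    ring
  simp_rw [h, ENNReal.tsum_mul_left]
  have := lintegral_countable' (μ := poissonMeasure r) (fun _ : ℕ => (1 : ℝ≥0∞))
  simp only [one_mul, lintegral_const, measure_univ] at this
  simp [← this]

/-- From `exp(-r) ≥ 1 - r`, one gets `1 - exp(-r)(1 + r) ≤ 1 - (1 - r)(1 + r) = r²`. The quadratic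
order is what forces simplicity of the point process. -/
theorem poissonMeasure_Ici_two_le (r : ℝ≥0) : poissonMeasure r (Set.Ici 2) ≤ r ^ 2 := by
  have h : (Set.Ici 2 : Set ℕ) = {0, 1}ᶜ := by
    ext n
    simp only [Set.mem_Ici, Set.mem_compl_iff, Set.mem_insert_iff, Set.mem_singleton_iff]
    omega
  have h0 : (poissonMeasure r).real (Set.Ici 2) ≤ (r : ℝ) ^ 2 := by
    rw [h, probReal_compl_eq_one_sub (by measurability), Set.insert_eq,
      measureReal_union (by simp) (by measurability), poissonMeasure_real_singleton,
      poissonMeasure_real_singleton]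
    have := Real.add_one_le_exp (-(r : ℝ))
    simp only [pow_zero, Nat.factorial_zero, Nat.factorial_one, pow_one]
    push_cast
    nlinarith [r.2, NNReal.coe_nonneg r]
  rw [← ENNReal.ofReal_coe_nnreal, ← ENNReal.ofReal_pow (NNReal.coe_nonneg r)]
  exact (ENNReal.le_ofReal_iff_toReal_le (measure_ne_top _ _) (by positivity)).2 h0

/-! ### Counts of the Poisson process, and its simplicity. -/

section

variable {d : ℕ} {Ω : Type*} [MeasurableSpace Ω] {P : Measure Ω} {lam : ℝ≥0}
  {ξ : ℤ → Ω → EuclideanSpace ℝ (Fin d)}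

theorem IsHomogeneousPoisson.measurable_apply (h : IsHomogeneousPoisson P lam ξ)
    {A : Set (EuclideanSpace ℝ (Fin d))} (hA : MeasurableSet A) :
    Measurable fun ω => pointProcess ξ ω A := by
  simp_rw [pointProcess_apply ξ _ hA]
  exact Measurable.tsum fun j => (measurable_one.indicator hA).comp (h.measurable j)

theorem IsHomogeneousPoisson.lintegral_apply (h : IsHomogeneousPoisson P lam ξ)
    {A : Set (EuclideanSpace ℝ (Fin d))} (hA : MeasurableSet A) (hA' : volume A ≠ ∞) :
    ∫⁻ ω, pointProcess ξ ω A ∂P = lam * volume A := by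
  have h1 := h.hasLaw A hA hA'
  rw [← lintegral_map' (f := fun x => x) aemeasurable_id h1.aemeasurable, h1.map_eq,
    lintegral_map (f := fun x => x) measurable_id (by fun_prop), lintegral_natCast_poissonMeasure]
  simp [ENNReal.coe_toNNReal hA']

theorem IsHomogeneousPoisson.measure_two_le_apply (h : IsHomogeneousPoisson P lam ξ)
    {A : Set (EuclideanSpace ℝ (Fin d))} (hA : MeasurableSet A) (hA' : volume A ≠ ∞) :
    P {ω | 2 ≤ pointProcess ξ ω A} ≤ (lam * volume A) ^ 2 := by
  have h1 := h.hasLaw A hA hA'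
  have hI : MeasurableSet {x : ℝ≥0∞ | 2 ≤ x} := measurableSet_Ici
  rw [h1.measure_eq hI, Measure.map_apply (by fun_prop) hI]
  convert poissonMeasure_Ici_two_le (lam * (volume A).toNNReal) using 2
  · ext n
    simp only [Set.mem_preimage, Set.mem_ofPred_eq, Set.mem_Ici]
    exact_mod_cast Iff.rfl
  · simp [ENNReal.coe_toNNReal hA']

/-- In dimension zero the infinitely many points would all sit at the single point of the space,
whose expected count is finite. -/
theorem IsHomogeneousPoisson.dim_pos [IsProbabilityMeasure P] (h : IsHomogeneousPoisson P lam ξ) :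
    0 < d := by
  rcases Nat.eq_zero_or_pos d with rfl | hd
  · exfalso
    have hv : volume (Set.univ : Set (EuclideanSpace ℝ (Fin 0))) ≠ ∞ :=
      (Set.toFinite _).isCompact.measure_ne_top
    have h1 := h.lintegral_apply MeasurableSet.univ hv
    simp_rw [pointProcess_apply ξ _ MeasurableSet.univ] at h1
    simp only [Set.indicator_univ, Pi.one_apply, ENNReal.tsum_const, mul_one,
      ENat.card_eq_top_of_infinite,
      lintegral_const, measure_univ] at h1
    exact ENNReal.mul_ne_top ENNReal.coe_ne_top hv (by simpa using h1.symm)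
  · exact hd

/-- A Poisson process is simple. -/
theorem IsHomogeneousPoisson.measure_eq_zero [IsProbabilityMeasure P]
    (h : IsHomogeneousPoisson P lam ξ) {i j : ℤ} (hij : i ≠ j) : P {ω | ξ i ω = ξ j ω} = 0 := by
  have : Nonempty (Fin d) := ⟨⟨0, h.dim_pos⟩⟩
  have hD : MeasurableSet {ω | ξ i ω = ξ j ω} :=
    measurableSet_eq_fun (h.measurable i) (h.measurable j)
  -- `ν` is the law of `ξ i` on the event of coincidence. There a point in `A` is counted twice, so
  -- `ν A` is at most quadratic in the volume of `A`.
  set ν : Measure (EuclideanSpace ℝ (Fin d)) := (P.restrict {ω | ξ i ω = ξ j ω}).map (ξ i) with hν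
  have hle : ∀ A, MeasurableSet A → volume A ≠ ∞ → ν A ≤ (lam * volume A) ^ 2 := by
    intro A hA hA'
    refine le_trans ?_ (h.measure_two_le_apply hA hA')
    rw [hν, Measure.map_apply (h.measurable i) hA, Measure.restrict_apply (h.measurable i hA)]
    refine measure_mono fun ω hω => ?_
    simp only [Set.mem_inter_iff, Set.mem_preimage, Set.mem_ofPred_eq] at hω ⊢
    rw [pointProcess_apply ξ _ hA]
    refine le_trans ?_ (ENNReal.sum_le_tsum {i, j})
    rw [Finset.sum_pair hij, ← hω.2, Set.indicator_of_mem hω.1]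
    simp [one_add_one_eq_two]
  have hac : ν ≪ volume := by
    refine Measure.AbsolutelyContinuous.mk fun A hA h0 => ?_
    simpa [h0] using hle A hA (by simp [h0])
  have hd : ν.rnDeriv volume =ᵐ[volume] 0 := by
    -- The density is the limit of `ν(ball) / vol(ball) ≤ lam² vol(ball)`, which tends to zero
    -- because points have volume zero in positive dimension.
    filter_upwards [Besicovitch.ae_tendsto_rnDeriv ν volume] with x hx
    refine tendsto_nhds_unique hx ?_
    have hv : Filter.Tendsto (fun r => volume (Metric.closedBall x r)) (nhdsWithin 0 (Set.Ioi 0))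
        (nhds 0) := by
      have := tendsto_measure_cthickening_of_isCompact (μ := volume) (isCompact_singleton (x := x))
      rw [measure_singleton] at this
      refine (this.mono_left nhdsWithin_le_nhds).congr' ?_
      filter_upwards [self_mem_nhdsWithin] with r hr
      rw [Metric.cthickening_singleton x (le_of_lt hr)]
    have hv2 : Filter.Tendsto (fun r => (lam : ℝ≥0∞) ^ 2 * volume (Metric.closedBall x r))
        (nhdsWithin 0 (Set.Ioi 0)) (nhds 0) := by
      simpa using ENNReal.Tendsto.const_mul (a := (lam : ℝ≥0∞) ^ 2) hv (Or.inr (by finiteness))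
    refine tendsto_of_tendsto_of_tendsto_of_le_of_le tendsto_const_nhds hv2
      (fun _ => zero_le) fun r => ?_
    refine ENNReal.div_le_of_le_mul ?_
    refine (hle _ measurableSet_closedBall measure_closedBall_lt_top.ne).trans_eq ?_
    ring
  have h0 : ν = 0 := by
    rw [← Measure.withDensity_rnDeriv_eq ν volume hac, withDensity_congr_ae hd, withDensity_zero]
  have h1 : ν Set.univ = 0 := by simp [h0]
  rwa [hν, Measure.map_apply (h.measurable i) MeasurableSet.univ, Set.preimage_univ,
    Measure.restrict_apply_univ] at h1

end

/-! ### Factorial moment measures of the Poisson process. -/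

/-- The `k`-th factorial moment measure of the point process `∑ⱼ ε_{ξⱼ}`. -/
noncomputable def factorialMeasure {Ω E : Type*} [MeasurableSpace Ω] [MeasurableSpace E]
    (P : Measure Ω) (ξ : ℤ → Ω → E) (k : ℕ) : Measure (Fin k → E) :=
  Measure.sum fun e : Fin k ↪ ℤ => P.map fun ω i => ξ (e i) ω

theorem lintegral_factorialMeasure {Ω E : Type*} [MeasurableSpace Ω] [MeasurableSpace E]
    (P : Measure Ω) {ξ : ℤ → Ω → E} (hξ : ∀ j, Measurable (ξ j)) {k : ℕ} {g : Fin k → E → ℝ≥0∞}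
    (hg : ∀ i, Measurable (g i)) :
    ∫⁻ x, ∏ i, g i (x i) ∂factorialMeasure P ξ k =
      ∫⁻ ω, distinctSum (fun i j => g i (ξ j ω)) ∂P := by
  rw [factorialMeasure, lintegral_sum_measure]
  unfold distinctSum
  have : Countable (Fin k ↪ ℤ) := DFunLike.coe_injective.countable
  rw [lintegral_tsum fun e => (Finset.measurable_fun_prod _ fun i _ =>
    show Measurable fun ω => g i (ξ (e i) ω) from (hg i).comp (hξ (e i))).aemeasurable]
  refine tsum_congr fun e => ?_
  exact lintegral_map (Finset.measurable_fun_prod _ fun i _ =>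
    (hg i).comp (measurable_pi_apply i)) (measurable_pi_lambda _ fun i => hξ (e i))

/-- The diagonal is a proper linear subspace since `d > 0`, hence null for the Haar measure. -/
theorem pi_smul_volume_diagonal {d : ℕ} {lam : ℝ≥0} (hd : 0 < d) (hl : 0 < lam) {k : ℕ}
    {a b : Fin k} (hab : a ≠ b) :
    Measure.pi (fun _ : Fin k => lam • (volume : Measure (EuclideanSpace ℝ (Fin d))))
      {x | x a = x b} = 0 := by
  have : (lam • (volume : Measure (EuclideanSpace ℝ (Fin d)))).IsAddHaarMeasure :=
    Measure.IsAddHaarMeasure.smul _ (by simpa using hl.ne') ENNReal.coe_ne_top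
  let S : Submodule ℝ (Fin k → EuclideanSpace ℝ (Fin d)) :=
    LinearMap.ker (LinearMap.proj (R := ℝ) (φ := fun _ : Fin k => EuclideanSpace ℝ (Fin d)) a -
      LinearMap.proj b)
  have hS : {x : Fin k → EuclideanSpace ℝ (Fin d) | x a = x b} = S := by
    ext x
    simp [S, sub_eq_zero]
  rw [hS]
  refine Measure.addHaar_submodule _ S fun hT => ?_
  have hx : (Pi.single a (EuclideanSpace.single ⟨0, hd⟩ 1) : Fin k → EuclideanSpace ℝ (Fin d)) ∈
      S := hT ▸ Submodule.mem_top
  have := congrArg (fun v : EuclideanSpace ℝ (Fin d) => v ⟨0, hd⟩) (LinearMap.mem_ker.1 hx)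
  simp [hab.symm] at this

section

variable {d : ℕ} {Ω : Type*} [MeasurableSpace Ω] {P : Measure Ω} {lam : ℝ≥0}
  {ξ : ℤ → Ω → EuclideanSpace ℝ (Fin d)}

/-- Disjoint sides reduce the sum over distinct indices to a product of counts, and these counts are
independent. -/
theorem IsHomogeneousPoisson.factorialMeasure_rectangle (h : IsHomogeneousPoisson P lam ξ) {k : ℕ}
    (A : Fin k → Set (EuclideanSpace ℝ (Fin d))) (hA : ∀ i, MeasurableSet (A i))
    (hA' : ∀ i, volume (A i) ≠ ∞) (hd : Pairwise fun i j => Disjoint (A i) (A j)) :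
    factorialMeasure P ξ k (Set.univ.pi A) = ∏ i, (lam • volume) (A i) := by
  have h1 : ∀ x : Fin k → EuclideanSpace ℝ (Fin d),
      (Set.univ.pi A).indicator (1 : (Fin k → EuclideanSpace ℝ (Fin d)) → ℝ≥0∞) x =
        ∏ i, (A i).indicator 1 (x i) := by
    intro x
    by_cases hx : x ∈ Set.univ.pi A
    · rw [Set.indicator_of_mem hx, Finset.prod_eq_one]
      · rfl
      · exact fun i _ => by rw [Set.indicator_of_mem (hx i (Set.mem_univ i))]; rfl
    · rw [Set.indicator_of_notMem hx]
      simp only [Set.mem_pi, Set.mem_univ, true_implies, not_forall] at hx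
      obtain ⟨i, hi⟩ := hx
      exact (Finset.prod_eq_zero (Finset.mem_univ i) (Set.indicator_of_notMem hi _)).symm
  rw [← lintegral_indicator_one (MeasurableSet.univ_pi hA)]
  simp_rw [h1]
  rw [lintegral_factorialMeasure P h.measurable fun i => measurable_one.indicator (hA i)]
  have h2 : ∀ ω, distinctSum (fun i j =>
      (A i).indicator (1 : EuclideanSpace ℝ (Fin d) → ℝ≥0∞) (ξ j ω)) =
      ∏ i, pointProcess ξ ω (A i) := by
    intro ω
    rw [distinctSum_eq_prod]
    · simp_rw [pointProcess_apply ξ ω (hA _)]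
    · intro i l hil
      ext j
      simp only [Pi.mul_apply, Pi.zero_apply, mul_eq_zero, Set.indicator_apply_eq_zero]
      by_contra! hc
      exact Set.disjoint_left.1 (hd hil) hc.1.1 hc.2.1
  simp_rw [h2]
  rw [lintegral_prod_eq_prod_lintegral_of_indepFun _ _ (h.indep k A hA hA' hd)
    fun i => h.measurable_apply (hA i)]
  refine Finset.prod_congr rfl fun i _ => ?_
  rw [h.lintegral_apply (hA i) (hA' i), Measure.smul_apply]
  rfl

variable [IsProbabilityMeasure P]

theorem IsHomogeneousPoisson.factorialMeasure_diagonal (h : IsHomogeneousPoisson P lam ξ) {k : ℕ}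
    {a b : Fin k} (hab : a ≠ b) : factorialMeasure P ξ k {x | x a = x b} = 0 := by
  have hm : MeasurableSet {x : Fin k → EuclideanSpace ℝ (Fin d) | x a = x b} :=
    measurableSet_eq_fun (measurable_pi_apply a) (measurable_pi_apply b)
  rw [factorialMeasure, Measure.sum_apply _ hm, ENNReal.tsum_eq_zero]
  intro e
  rw [Measure.map_apply (measurable_pi_lambda _ fun i => h.measurable (e i)) hm]
  exact h.measure_eq_zero (e.injective.ne hab)

/-- The factorial moment measures of a homogeneous Poisson process are product measures. -/
theorem IsHomogeneousPoisson.factorialMeasure_eq_pi (h : IsHomogeneousPoisson P lam ξ)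
    (hl : 0 < lam) (k : ℕ) :
    factorialMeasure P ξ k = Measure.pi fun _ => lam • volume := by
  -- Every tuple with distinct coordinates lies in an open box with disjoint sides of finite volume.
  -- Countably many such boxes cover all these tuples, and what remains lies in finitely many
  -- diagonals, null for both measures.
  have hU : ∀ x : Fin k → EuclideanSpace ℝ (Fin d), Function.Injective x →
      ∃ A : Fin k → Set (EuclideanSpace ℝ (Fin d)), (∀ i, x i ∈ A i ∧ IsOpen (A i)) ∧
        (∀ i, volume (A i) ≠ ∞) ∧ Pairwise fun i j => Disjoint (A i) (A j) := by
    intro x hx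
    obtain ⟨U, hU, hUd⟩ := (Set.finite_range x).t2_separation
    refine ⟨fun i => U (x i) ∩ Metric.ball (x i) 1, fun i => ⟨⟨(hU _).1, by simp⟩,
      (hU _).2.inter Metric.isOpen_ball⟩, fun i => ?_, fun i j hij => ?_⟩
    · exact measure_ne_top_of_subset Set.inter_subset_right measure_ball_lt_top.ne
    · exact (hUd (Set.mem_range_self i) (Set.mem_range_self j) (hx.ne hij)).mono
        Set.inter_subset_left Set.inter_subset_left
  choose! A hxA hA' hAd using hU
  obtain ⟨t, ht, htc, hcov⟩ := TopologicalSpace.countable_cover_nhdsWithin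
    (s := {x : Fin k → EuclideanSpace ℝ (Fin d) | Function.Injective x})
    (f := fun x => Set.univ.pi (A x)) fun x hx =>
      mem_nhdsWithin_of_mem_nhds <| (isOpen_set_pi Set.finite_univ
        fun i _ => (hxA x hx i).2).mem_nhds fun i _ => (hxA x hx i).1
  set W := ⋃ x ∈ t, Set.univ.pi (A x) with hW
  have hWm : MeasurableSet W := MeasurableSet.biUnion htc fun x hx =>
    MeasurableSet.univ_pi fun i => (hxA x (ht hx) i).2.measurableSet
  have hWc : Wᶜ ⊆ ⋃ p : {p : Fin k × Fin k // p.1 ≠ p.2}, {x | x p.1.1 = x p.1.2} := by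
    intro x hx
    have : ¬ Function.Injective x := fun hi => hx (hcov hi)
    simp only [Function.Injective, not_forall] at this
    obtain ⟨a, b, hab, hne⟩ := this
    exact Set.mem_iUnion.2 ⟨⟨(a, b), hne⟩, hab⟩
  have h1 : (factorialMeasure P ξ k).restrict W =
      (Measure.pi fun _ => lam • volume).restrict W := by
    rw [hW, Measure.restrict_biUnion_congr htc]
    intro x hx
    -- Intersecting a good box with a measurable rectangle leaves the sides disjoint, so the
    -- rectangle formula determines the restricted measure.
    rw [Measure.restrict_pi_pi]
    refine (Measure.pi_eq fun s hs => ?_).symm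
    rw [Measure.restrict_apply (MeasurableSet.univ_pi hs), ← Set.pi_inter_distrib,
      h.factorialMeasure_rectangle _ fun i => (hs i).inter (hxA x (ht hx) i).2.measurableSet]
    · exact Finset.prod_congr rfl fun i _ => (Measure.restrict_apply (hs i)).symm
    · exact fun i => measure_ne_top_of_subset Set.inter_subset_right (hA' x (ht hx) i)
    · exact fun i j hij => (hAd x (ht hx) hij).mono Set.inter_subset_right Set.inter_subset_right
  have h2 : (factorialMeasure P ξ k).restrict Wᶜ =
      (Measure.pi fun _ => lam • volume).restrict Wᶜ := by
    rw [Measure.restrict_eq_zero.2, Measure.restrict_eq_zero.2]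
    · exact measure_mono_null hWc <| measure_iUnion_null fun p =>
        pi_smul_volume_diagonal h.dim_pos hl p.2
    · exact measure_mono_null hWc <| measure_iUnion_null fun p =>
        h.factorialMeasure_diagonal p.2
  rw [← Measure.restrict_add_restrict_compl (μ := factorialMeasure P ξ k) hWm, h1, h2,
    Measure.restrict_add_restrict_compl hWm]

theorem IsHomogeneousPoisson.lintegral_distinctSum (h : IsHomogeneousPoisson P lam ξ)
    (hl : 0 < lam) {k : ℕ} {g : Fin k → EuclideanSpace ℝ (Fin d) → ℝ≥0∞}
    (hg : ∀ i, Measurable (g i)) :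
    ∫⁻ ω, distinctSum (fun i j => g i (ξ j ω)) ∂P = ∏ i, (lam * ∫⁻ x, g i x) := by
  rw [← lintegral_factorialMeasure P h.measurable hg, h.factorialMeasure_eq_pi hl,
    lintegral_pi_prod_eq_prod _ _ hg]
  exact Finset.prod_congr rfl fun i _ => lintegral_smul_measure _ _

end

/-! ### Adding the displacement paths as independent marks. -/

section Marked

variable {d : ℕ} {Ω Ω' : Type*} [MeasurableSpace Ω] [MeasurableSpace Ω'] {P : Measure Ω}
  [IsProbabilityMeasure P] {P' : Measure Ω'} [IsProbabilityMeasure P'] {lam : ℝ≥0}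
  {Y : ℝ≥0 → Ω' → EuclideanSpace ℝ (Fin d)} {ξ : ℤ → Ω → EuclideanSpace ℝ (Fin d)}
  {Yp : ℤ → ℝ≥0 → Ω → EuclideanSpace ℝ (Fin d)}

/-- The factorial moments of the marked Poisson process `∑ⱼ ε_{(ξⱼ, Yⱼ)}`. -/
theorem IsParticleSystem.lintegral_distinctSum (h : IsParticleSystem P P' lam Y ξ Yp)
    (hl : 0 < lam) {k : ℕ}
    {F : Fin k → EuclideanSpace ℝ (Fin d) → (ℝ≥0 → EuclideanSpace ℝ (Fin d)) → ℝ≥0∞}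
    (hF : ∀ i, Measurable (Function.uncurry (F i))) :
    ∫⁻ ω, distinctSum (fun i j => F i (ξ j ω) fun t => Yp j t ω) ∂P =
      ∏ i, (lam * ∫⁻ x, ∫⁻ ω, F i x (fun t => Y t ω) ∂P') := by
  have hY : Measurable fun ω t => Y t ω := measurable_pi_lambda _ h.measurable_generic
  have hYp : ∀ j, Measurable fun ω t => Yp j t ω :=
    fun j => measurable_pi_lambda _ (h.measurable_copy j)
  set Q := P'.map fun ω t => Y t ω with hQ
  have : IsProbabilityMeasure Q := Measure.isProbabilityMeasure_map hY.aemeasurable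
  have hg : ∀ i, Measurable fun x => ∫⁻ y, F i x y ∂Q := fun i => (hF i).lintegral_prod_right'
  have hgQ : ∀ i x, ∫⁻ ω, F i x (fun t => Y t ω) ∂P' = ∫⁻ y, F i x y ∂Q := fun i x =>
    (lintegral_map ((hF i).comp measurable_prodMk_left) hY).symm
  simp_rw [hgQ]
  rw [← h.poisson.lintegral_distinctSum hl hg]
  unfold distinctSum
  have : Countable (Fin k ↪ ℤ) := DFunLike.coe_injective.countable
  rw [lintegral_tsum, lintegral_tsum]
  -- For a fixed tuple of distinct indices the marks are i.i.d. with law `Q` and independent of the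
  -- positions. Integrating them out first replaces each `F i` by its average over `Q`, which leaves
  -- the unmarked case.
  · refine tsum_congr fun e => ?_
    have hξe : Measurable fun ω i => ξ (e i) ω := measurable_pi_lambda _ fun i =>
      h.poisson.measurable (e i)
    have hYe : Measurable fun ω i t => Yp (e i) t ω := measurable_pi_lambda _ fun i => hYp (e i)
    have hind : IndepFun (fun ω i => ξ (e i) ω) (fun ω i t => Yp (e i) t ω) P :=
      h.indep_initial.comp (φ := fun x i => x (e i)) (ψ := fun y i => y (e i))
        (measurable_pi_lambda _ fun i => measurable_pi_apply _)
        (measurable_pi_lambda _ fun i => measurable_pi_apply _)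
    have hlaw : P.map (fun ω i t => Yp (e i) t ω) = Measure.pi fun _ => Q := by
      have := (iIndepFun_iff_map_fun_eq_pi_map fun i => (hYp (e i)).aemeasurable).1
        (h.iIndep_copies.precomp e.injective)
      rw [this]
      congr 1
      ext1 i
      exact (h.identDistrib (e i)).map_eq
    have hFm : Measurable fun p : (Fin k → EuclideanSpace ℝ (Fin d)) ×
        (Fin k → ℝ≥0 → EuclideanSpace ℝ (Fin d)) => ∏ i, F i (p.1 i) (p.2 i) :=
      Finset.measurable_fun_prod _ fun i _ => (hF i).comp
        (f := fun p : (Fin k → EuclideanSpace ℝ (Fin d)) ×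
          (Fin k → ℝ≥0 → EuclideanSpace ℝ (Fin d)) => (p.1 i, p.2 i))
        (((measurable_pi_apply i).comp measurable_fst).prodMk
          ((measurable_pi_apply i).comp measurable_snd))
    calc ∫⁻ ω, ∏ i, F i (ξ (e i) ω) (fun t => Yp (e i) t ω) ∂P
        = ∫⁻ p, ∏ i, F i (p.1 i) (p.2 i)
            ∂P.map fun ω => ((fun i => ξ (e i) ω), fun i t => Yp (e i) t ω) :=
          (lintegral_map hFm (hξe.prodMk hYe)).symm
      _ = ∫⁻ x, ∫⁻ y, ∏ i, F i (x i) (y i) ∂Measure.pi (fun _ => Q)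
            ∂P.map fun ω i => ξ (e i) ω := by
          rw [(indepFun_iff_map_prod_eq_prod_map_map hξe.aemeasurable hYe.aemeasurable).1 hind,
            hlaw, lintegral_prod _ hFm.aemeasurable]
      _ = ∫⁻ x, ∏ i, ∫⁻ y, F i (x i) y ∂Q ∂P.map fun ω i => ξ (e i) ω :=
          lintegral_congr fun x => lintegral_pi_prod_eq_prod Q _ fun i =>
            (hF i).comp measurable_prodMk_left
      _ = ∫⁻ ω, ∏ i, ∫⁻ y, F i (ξ (e i) ω) y ∂Q ∂P :=
          lintegral_map (Finset.measurable_fun_prod _ fun i _ =>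
            (hg i).comp (measurable_pi_apply i)) hξe
  · exact fun e => (Finset.measurable_fun_prod _ fun i _ =>
      (hg i).comp (h.poisson.measurable (e i))).aemeasurable
  · exact fun e => (Finset.measurable_fun_prod _ fun i _ =>
      (hF i).comp ((h.poisson.measurable (e i)).prodMk (hYp (e i)))).aemeasurable

end Marked

/-! ### Joint moments, up to order four, of sums over the marked process. -/

/-- Carrying measurability along with the value lets long sums be integrated term by term without
side goals. -/
theorem measurable_lintegral_add {Ω : Type*} [MeasurableSpace Ω] {P : Measure Ω}
    {f g : Ω → ℝ≥0∞} {u v : ℝ≥0∞} (hf : Measurable f ∧ ∫⁻ ω, f ω ∂P = u)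
    (hg : Measurable g ∧ ∫⁻ ω, g ω ∂P = v) :
    Measurable (fun ω => f ω + g ω) ∧ ∫⁻ ω, f ω + g ω ∂P = u + v :=
  ⟨hf.1.add hg.1, by rw [lintegral_add_left hf.1, hf.2, hg.2]⟩

/-- The values of `F` at the points of the marked process `∑ⱼ ε_{(ξⱼ, Yⱼ)}`. -/
def markedValue {d : ℕ} {Ω : Type*} (ξ : ℤ → Ω → EuclideanSpace ℝ (Fin d))
    (Yp : ℤ → ℝ≥0 → Ω → EuclideanSpace ℝ (Fin d))
    (F : EuclideanSpace ℝ (Fin d) × (ℝ≥0 → EuclideanSpace ℝ (Fin d)) → ℝ≥0∞) (ω : Ω) (j : ℤ) :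
    ℝ≥0∞ :=
  F (ξ j ω, fun t => Yp j t ω)

theorem markedValue_mul {d : ℕ} {Ω : Type*} (ξ : ℤ → Ω → EuclideanSpace ℝ (Fin d))
    (Yp : ℤ → ℝ≥0 → Ω → EuclideanSpace ℝ (Fin d)) (f g : EuclideanSpace ℝ (Fin d) ×
    (ℝ≥0 → EuclideanSpace ℝ (Fin d)) → ℝ≥0∞) (ω : Ω) :
    markedValue ξ Yp f ω * markedValue ξ Yp g ω = markedValue ξ Yp (f * g) ω :=
  rfl

section Moments

variable {d : ℕ} {Ω Ω' : Type*} [MeasurableSpace Ω] [MeasurableSpace Ω'] {P : Measure Ω}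
  {P' : Measure Ω'} {lam : ℝ≥0}
  {Y : ℝ≥0 → Ω' → EuclideanSpace ℝ (Fin d)} {ξ : ℤ → Ω → EuclideanSpace ℝ (Fin d)}
  {Yp : ℤ → ℝ≥0 → Ω → EuclideanSpace ℝ (Fin d)}

/-- The integral of `F` against the intensity of the marked process `∑ⱼ ε_{(ξⱼ, Yⱼ)}`. -/
noncomputable def intensity (P' : Measure Ω') (lam : ℝ≥0)
    (Y : ℝ≥0 → Ω' → EuclideanSpace ℝ (Fin d))
    (F : EuclideanSpace ℝ (Fin d) × (ℝ≥0 → EuclideanSpace ℝ (Fin d)) → ℝ≥0∞) : ℝ≥0∞ :=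
  lam * ∫⁻ x, ∫⁻ ω, F (x, fun t => Y t ω) ∂P'

theorem IsParticleSystem.measurable_markedValue (h : IsParticleSystem P P' lam Y ξ Yp)
    {F : EuclideanSpace ℝ (Fin d) × (ℝ≥0 → EuclideanSpace ℝ (Fin d)) → ℝ≥0∞} (hF : Measurable F)
    (j : ℤ) : Measurable fun ω => markedValue ξ Yp F ω j :=
  hF.comp ((h.poisson.measurable j).prodMk (measurable_pi_lambda _ (h.measurable_copy j)))

theorem IsParticleSystem.measurable_distinctSum (h : IsParticleSystem P P' lam Y ξ Yp) {k : ℕ}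
    {F : Fin k → EuclideanSpace ℝ (Fin d) × (ℝ≥0 → EuclideanSpace ℝ (Fin d)) → ℝ≥0∞}
    (hF : ∀ i, Measurable (F i)) :
    Measurable fun ω => distinctSum fun i => markedValue ξ Yp (F i) ω := by
  have : Countable (Fin k ↪ ℤ) := DFunLike.coe_injective.countable
  exact Measurable.tsum fun e => Finset.measurable_fun_prod _ fun i _ =>
    h.measurable_markedValue (hF i) (e i)

variable [IsProbabilityMeasure P] [IsProbabilityMeasure P']

theorem IsParticleSystem.lintegral_distinctSum_markedValue
    (h : IsParticleSystem P P' lam Y ξ Yp) (hl : 0 < lam) {k : ℕ}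
    {F : Fin k → EuclideanSpace ℝ (Fin d) × (ℝ≥0 → EuclideanSpace ℝ (Fin d)) → ℝ≥0∞}
    (hF : ∀ i, Measurable (F i)) :
    ∫⁻ ω, distinctSum (fun i => markedValue ξ Yp (F i) ω) ∂P = ∏ i, intensity P' lam Y (F i) :=
  h.lintegral_distinctSum (F := fun i x y => F i (x, y)) hl hF

section

variable {f g k l : EuclideanSpace ℝ (Fin d) × (ℝ≥0 → EuclideanSpace ℝ (Fin d)) → ℝ≥0∞}

/-- The cases of one to four factors are written in vector notation, the shape in which the
expansion of products of sums delivers them. -/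
theorem IsParticleSystem.lintegral_one (h : IsParticleSystem P P' lam Y ξ Yp) (hl : 0 < lam)
    (hf : Measurable f) :
    Measurable (fun ω => distinctSum ![markedValue ξ Yp f ω]) ∧
    ∫⁻ ω, distinctSum ![markedValue ξ Yp f ω] ∂P = intensity P' lam Y f := by
  have hF : ∀ i, Measurable (![f] i) := by intro i; fin_cases i; assumption
  have he : ∀ ω, (fun i => markedValue ξ Yp (![f] i) ω) = ![markedValue ξ Yp f ω] := by
    intro ω; ext i; fin_cases i; rfl
  have h1 := h.measurable_distinctSum hF
  have h2 := h.lintegral_distinctSum_markedValue hl hF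
  simp_rw [he] at h1 h2
  exact ⟨h1, by simpa using h2⟩

theorem IsParticleSystem.lintegral_two (h : IsParticleSystem P P' lam Y ξ Yp) (hl : 0 < lam)
    (hf : Measurable f) (hg : Measurable g) :
    Measurable (fun ω => distinctSum ![markedValue ξ Yp f ω, markedValue ξ Yp g ω]) ∧
    ∫⁻ ω, distinctSum ![markedValue ξ Yp f ω, markedValue ξ Yp g ω] ∂P =
      intensity P' lam Y f * intensity P' lam Y g := by
  have hF : ∀ i, Measurable (![f, g] i) := by intro i; fin_cases i <;> assumption
  have he : ∀ ω, (fun i => markedValue ξ Yp (![f, g] i) ω) =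
      ![markedValue ξ Yp f ω, markedValue ξ Yp g ω] := by
    intro ω; ext i; fin_cases i <;> rfl
  have h1 := h.measurable_distinctSum hF
  have h2 := h.lintegral_distinctSum_markedValue hl hF
  simp_rw [he] at h1 h2
  exact ⟨h1, by simpa [Fin.prod_univ_succ] using h2⟩

theorem IsParticleSystem.lintegral_three (h : IsParticleSystem P P' lam Y ξ Yp) (hl : 0 < lam)
    (hf : Measurable f) (hg : Measurable g) (hk : Measurable k) :
    Measurable (fun ω => distinctSum
      ![markedValue ξ Yp f ω, markedValue ξ Yp g ω, markedValue ξ Yp k ω]) ∧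
    ∫⁻ ω, distinctSum ![markedValue ξ Yp f ω, markedValue ξ Yp g ω, markedValue ξ Yp k ω] ∂P =
      intensity P' lam Y f * intensity P' lam Y g * intensity P' lam Y k := by
  have hF : ∀ i, Measurable (![f, g, k] i) := by intro i; fin_cases i <;> assumption
  have he : ∀ ω, (fun i => markedValue ξ Yp (![f, g, k] i) ω) =
      ![markedValue ξ Yp f ω, markedValue ξ Yp g ω, markedValue ξ Yp k ω] := by
    intro ω; ext i; fin_cases i <;> rfl
  have h1 := h.measurable_distinctSum hF
  have h2 := h.lintegral_distinctSum_markedValue hl hF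
  simp_rw [he] at h1 h2
  exact ⟨h1, by simpa [Fin.prod_univ_succ, mul_assoc] using h2⟩

theorem IsParticleSystem.lintegral_four (h : IsParticleSystem P P' lam Y ξ Yp) (hl : 0 < lam)
    (hf : Measurable f) (hg : Measurable g) (hk : Measurable k) (hl' : Measurable l) :
    Measurable (fun ω => distinctSum ![markedValue ξ Yp f ω, markedValue ξ Yp g ω,
      markedValue ξ Yp k ω, markedValue ξ Yp l ω]) ∧
    ∫⁻ ω, distinctSum ![markedValue ξ Yp f ω, markedValue ξ Yp g ω, markedValue ξ Yp k ω,
        markedValue ξ Yp l ω] ∂P =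
      intensity P' lam Y f * intensity P' lam Y g * intensity P' lam Y k *
        intensity P' lam Y l := by
  have hF : ∀ i, Measurable (![f, g, k, l] i) := by intro i; fin_cases i <;> assumption
  have he : ∀ ω, (fun i => markedValue ξ Yp (![f, g, k, l] i) ω) = ![markedValue ξ Yp f ω,
      markedValue ξ Yp g ω, markedValue ξ Yp k ω, markedValue ξ Yp l ω] := by
    intro ω; ext i; fin_cases i <;> rfl
  have h1 := h.measurable_distinctSum hF
  have h2 := h.lintegral_distinctSum_markedValue hl hF
  simp_rw [he] at h1 h2
  exact ⟨h1, by simpa [Fin.prod_univ_succ, mul_assoc] using h2⟩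

theorem IsParticleSystem.lintegral_tsum (h : IsParticleSystem P P' lam Y ξ Yp) (hl : 0 < lam)
    (hf : Measurable f) :
    ∫⁻ ω, ∑' j, markedValue ξ Yp f ω j ∂P = intensity P' lam Y f := by
  simp_rw [← distinctSum_singleton]
  exact (h.lintegral_one hl hf).2

theorem IsParticleSystem.lintegral_tsum_mul_tsum (h : IsParticleSystem P P' lam Y ξ Yp)
    (hl : 0 < lam) (hf : Measurable f) (hg : Measurable g) :
    ∫⁻ ω, (∑' j, markedValue ξ Yp f ω j) * ∑' j, markedValue ξ Yp g ω j ∂P =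
      intensity P' lam Y f * intensity P' lam Y g + intensity P' lam Y (f * g) := by
  simp_rw [tsum_mul_tsum, markedValue_mul]
  rw [lintegral_add_right _ (h.lintegral_one hl (hf.mul hg)).1, (h.lintegral_two hl hf hg).2,
    (h.lintegral_one hl (hf.mul hg)).2]

theorem IsParticleSystem.lintegral_tsum_mul_tsum_mul_tsum (h : IsParticleSystem P P' lam Y ξ Yp)
    (hl : 0 < lam) (hf : Measurable f) (hg : Measurable g) (hk : Measurable k) :
    ∫⁻ ω, (∑' j, markedValue ξ Yp f ω j) * ((∑' j, markedValue ξ Yp g ω j) *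
      ∑' j, markedValue ξ Yp k ω j) ∂P =
      intensity P' lam Y f * intensity P' lam Y g * intensity P' lam Y k +
      intensity P' lam Y (f * g) * intensity P' lam Y k +
      intensity P' lam Y g * intensity P' lam Y (f * k) +
      (intensity P' lam Y f * intensity P' lam Y (g * k) +
      intensity P' lam Y (f * (g * k))) := by
  simp_rw [tsum_mul_tsum, mul_add, tsum_mul_distinctSum_two, distinctSum_singleton, tsum_mul_tsum,
    markedValue_mul]
  have m1 {f} (hf) := h.lintegral_one (f := f) hl hf
  have m2 {f g} (hf hg) := h.lintegral_two (f := f) (g := g) hl hf hg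
  exact (measurable_lintegral_add (measurable_lintegral_add (measurable_lintegral_add
    (h.lintegral_three hl hf hg hk) (m2 (hf.mul hg) hk)) (m2 hg (hf.mul hk)))
    (measurable_lintegral_add (m2 hf (hg.mul hk)) (m1 (hf.mul (hg.mul hk))))).2

/-- The fifteen terms are the set partitions of four factors, grouped by block sizes: one of type
1+1+1+1, six of type 2+1+1, three of type 2+2, four of type 3+1, one of type 4. -/
theorem IsParticleSystem.lintegral_tsum_mul_tsum_mul_tsum_mul_tsum
    (h : IsParticleSystem P P' lam Y ξ Yp)
    (hl : 0 < lam) (hf : Measurable f) (hg : Measurable g) (hk : Measurable k)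
    (hl' : Measurable l) :
    ∫⁻ ω, (∑' j, markedValue ξ Yp f ω j) * ((∑' j, markedValue ξ Yp g ω j) *
      ((∑' j, markedValue ξ Yp k ω j) * ∑' j, markedValue ξ Yp l ω j)) ∂P =
      intensity P' lam Y f * (intensity P' lam Y g * intensity P' lam Y k * intensity P' lam Y l) +
      (intensity P' lam Y f * (intensity P' lam Y (g * k) * intensity P' lam Y l) +
      intensity P' lam Y f * (intensity P' lam Y k * intensity P' lam Y (g * l)) +
      intensity P' lam Y f * (intensity P' lam Y g * intensity P' lam Y (k * l)) +
      intensity P' lam Y (f * g) * intensity P' lam Y k * intensity P' lam Y l +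
      intensity P' lam Y g * intensity P' lam Y (f * k) * intensity P' lam Y l +
      intensity P' lam Y g * intensity P' lam Y k * intensity P' lam Y (f * l)) +
      (intensity P' lam Y (f * g) * intensity P' lam Y (k * l) +
      intensity P' lam Y (f * k) * intensity P' lam Y (g * l) +
      intensity P' lam Y (g * k) * intensity P' lam Y (f * l)) +
      (intensity P' lam Y f * intensity P' lam Y (g * (k * l)) +
      intensity P' lam Y g * intensity P' lam Y (f * (k * l)) +
      intensity P' lam Y (f * (g * k)) * intensity P' lam Y l +
      intensity P' lam Y k * intensity P' lam Y (f * (g * l))) +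
      intensity P' lam Y (f * (g * (k * l))) := by
  simp_rw [tsum_mul_tsum, mul_add, tsum_mul_distinctSum_two, distinctSum_singleton, tsum_mul_tsum,
    mul_add, tsum_mul_distinctSum_three, tsum_mul_distinctSum_two, distinctSum_singleton,
    tsum_mul_tsum, markedValue_mul]
  have m1 {f} (hf) := h.lintegral_one (f := f) hl hf
  have m2 {f g} (hf hg) := h.lintegral_two (f := f) (g := g) hl hf hg
  have m3 {f g k} (hf hg hk) := h.lintegral_three (f := f) (g := g) (k := k) hl hf hg hk
  have m4 := h.lintegral_four hl hf hg hk hl'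
  have m3_add {f g k} (hf hg hk) := measurable_lintegral_add (measurable_lintegral_add
    (m3 (f := f) (g := g) (k := k) hf hg hk) (m2 (hf.mul hg) hk)) (m2 hg (hf.mul hk))
  refine (measurable_lintegral_add (measurable_lintegral_add (measurable_lintegral_add
    (measurable_lintegral_add (measurable_lintegral_add (measurable_lintegral_add
      m4 (m3 (hf.mul hg) hk hl')) (m3 hg (hf.mul hk) hl')) (m3 hg hk (hf.mul hl')))
    (m3_add hf (hg.mul hk) hl')) (m3_add hf hk (hg.mul hl')))
    (measurable_lintegral_add (m3_add hf hg (hk.mul hl'))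
      (measurable_lintegral_add (m2 hf (hg.mul (hk.mul hl')))
        (m1 (hf.mul (hg.mul (hk.mul hl'))))))).2.trans ?_
  ring

end

end Moments

/-! ### Hitting indicators and the functionals `U` and `H`. -/

theorem mem_shift_iff {d : ℕ} {B : Set (EuclideanSpace ℝ (Fin d))}
    {x y : EuclideanSpace ℝ (Fin d)} : y ∈ shift B x ↔ y + x ∈ B :=
  ⟨fun ⟨z, hz, h⟩ => by simpa [h] using hz, fun h => ⟨_, h, by simp⟩⟩

theorem volume_shift {d : ℕ} (B : Set (EuclideanSpace ℝ (Fin d)))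
    (x : EuclideanSpace ℝ (Fin d)) : volume (shift B x) = volume B := by
  rw [← measure_preimage_add_right volume x B]
  congr 1
  ext y
  exact mem_shift_iff

theorem measurableSet_shift {d : ℕ} {B : Set (EuclideanSpace ℝ (Fin d))} (hB : MeasurableSet B)
    (x : EuclideanSpace ℝ (Fin d)) : MeasurableSet (shift B x) := by
  have : shift B x = (· + x) ⁻¹' B := by
    ext y
    exact mem_shift_iff
  rw [this]
  exact measurable_add_const x hB

theorem volume_iInter_shift_le {d k : ℕ} (B : Set (EuclideanSpace ℝ (Fin d)))
    (x : Fin k → EuclideanSpace ℝ (Fin d)) (i : Fin k) :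
    volume (⋂ i, shift B (x i)) ≤ volume B :=
  (measure_mono (Set.iInter_subset _ i)).trans_eq (volume_shift B _)

/-- The indicator that a particle which starts at `p.1` and has displacement path `p.2` is in `B`
at time `t`. -/
noncomputable def hit {d : ℕ} (B : Set (EuclideanSpace ℝ (Fin d))) (t : ℝ≥0)
    (p : EuclideanSpace ℝ (Fin d) × (ℝ≥0 → EuclideanSpace ℝ (Fin d))) : ℝ≥0∞ :=
  B.indicator (fun _ => 1) (p.1 + p.2 t)

theorem measurable_hit {d : ℕ} {B : Set (EuclideanSpace ℝ (Fin d))} (hB : MeasurableSet B)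
    (t : ℝ≥0) : Measurable (hit B t) :=
  (measurable_const.indicator hB).comp
    (measurable_fst.add ((measurable_pi_apply t).comp measurable_snd))

theorem prod_hit {d k : ℕ} (B : Set (EuclideanSpace ℝ (Fin d))) (t : Fin k → ℝ≥0)
    (x : EuclideanSpace ℝ (Fin d)) (y : ℝ≥0 → EuclideanSpace ℝ (Fin d)) :
    ∏ i, hit B (t i) (x, y) = (⋂ i, shift B (y (t i))).indicator 1 x := by
  by_cases hx : x ∈ ⋂ i, shift B (y (t i))
  · rw [Set.indicator_of_mem hx, Finset.prod_eq_one]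
    · rfl
    · exact fun i _ => Set.indicator_of_mem (mem_shift_iff.1 (Set.mem_iInter.1 hx i)) _
  · rw [Set.indicator_of_notMem hx]
    simp only [Set.mem_iInter, not_forall] at hx
    obtain ⟨i, hi⟩ := hx
    exact Finset.prod_eq_zero (Finset.mem_univ i)
      (Set.indicator_of_notMem (fun h => hi (mem_shift_iff.2 h)) _)

/-- A finite integral makes `f` finite almost everywhere, so `toReal` loses nothing. This carries
the moment identities from `ℝ≥0∞` over to `N`. -/
theorem integrable_toReal_and_integral {α : Type*} [MeasurableSpace α] {μ : Measure α}
    {f : α → ℝ≥0∞} {v : ℝ≥0∞} (hf : AEMeasurable f μ) (h : ∫⁻ a, f a ∂μ = v) (hv : v ≠ ∞) :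
    Integrable (fun a => (f a).toReal) μ ∧ ∫ a, (f a).toReal ∂μ = v.toReal := by
  subst h
  exact ⟨integrable_toReal_of_lintegral_ne_top hf hv,
    integral_toReal hf (ae_lt_top' hf hv)⟩

section Functionals

variable {d : ℕ} {Ω' : Type*} [MeasurableSpace Ω'] {P' : Measure Ω'}
  {lam : ℝ≥0} {B : Set (EuclideanSpace ℝ (Fin d))} {Y : ℝ≥0 → Ω' → EuclideanSpace ℝ (Fin d)}

theorem measurable_volume_iInter_shift (hB : MeasurableSet B) (hY : ∀ t, Measurable (Y t)) {k : ℕ}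
    (t : Fin k → ℝ≥0) : Measurable fun ω => volume (⋂ i, shift B (Y (t i) ω)) := by
  have hm : MeasurableSet {p : EuclideanSpace ℝ (Fin d) × Ω' | ∀ i, p.1 + Y (t i) p.2 ∈ B} := by
    rw [Set.ofPred_forall]
    exact MeasurableSet.iInter fun i =>
      (measurable_fst.add ((hY (t i)).comp measurable_snd)) hB
  convert measurable_measure_prodMk_right (μ := volume) hm using 2 with ω
  congr 1
  ext x
  simp [mem_shift_iff]

theorem rho_nonneg : 0 ≤ rho lam B :=
  mul_nonneg lam.2 measureReal_nonneg

theorem U_nonneg {k : ℕ} (t : Fin k → ℝ≥0) : 0 ≤ U P' B Y t :=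
  mul_nonneg (by positivity) (integral_nonneg fun _ => measureReal_nonneg)

theorem H_eq_U (hY0 : ∀ᵐ ω ∂P', Y 0 ω = 0) (x : ℝ) :
    H P' B Y x = U P' B Y ![0, Real.nnabs x] := by
  unfold H U
  congr 1
  refine integral_congr_ae ?_
  filter_upwards [hY0] with ω hω
  congr 1
  ext y
  simp [mem_shift_iff, Fin.forall_fin_two, hω]

variable [IsProbabilityMeasure P']

/-- For a fixed path, the starting points that put the particle in `B` at all given times are the
intersection of the translates. The rest is Tonelli. -/
theorem intensity_prod_hit (hB : MeasurableSet B) (hY : ∀ t, Measurable (Y t)) {k : ℕ}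
    (t : Fin k → ℝ≥0) :
    intensity P' lam Y (∏ i, hit B (t i)) =
      lam * ∫⁻ ω, volume (⋂ i, shift B (Y (t i) ω)) ∂P' := by
  have hm : Measurable fun p : EuclideanSpace ℝ (Fin d) × Ω' =>
      (∏ i, hit B (t i)) (p.1, fun t => Y t p.2) := by
    have := Finset.measurable_prod Finset.univ fun i _ => measurable_hit hB (t i)
    simp_rw [← Finset.prod_apply] at this
    exact this.comp
      (measurable_fst.prodMk (measurable_pi_lambda _ fun t => (hY t).comp measurable_snd))
  rw [intensity, lintegral_lintegral_swap hm.aemeasurable]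
  congr 1
  refine lintegral_congr fun ω => ?_
  simp_rw [Finset.prod_apply, prod_hit]
  exact lintegral_indicator_one (MeasurableSet.iInter fun i => measurableSet_shift hB _)

theorem integrable_volume_iInter_shift (hB : MeasurableSet B) (hB' : volume B ≠ ∞)
    (hY : ∀ t, Measurable (Y t)) {k : ℕ} [NeZero k]
    (t : Fin k → ℝ≥0) :
    Integrable (fun ω => volume.real (⋂ i, shift B (Y (t i) ω))) P' := by
  refine Integrable.of_bound (C := volume.real B)
    (measurable_volume_iInter_shift hB hY t).ennreal_toReal.aestronglyMeasurable
    (Filter.Eventually.of_forall fun ω => ?_)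
  rw [Real.norm_of_nonneg measureReal_nonneg]
  exact ENNReal.toReal_mono hB' (volume_iInter_shift_le B _ 0)

/-- At least one time is needed: an empty intersection would be the whole space, of infinite volume.
-/
theorem intensity_prod_hit_eq_ofReal (hB : MeasurableSet B)
    (hB' : volume B ≠ ∞) (hB0 : volume B ≠ 0)
    (hY : ∀ t, Measurable (Y t)) {k : ℕ} [NeZero k]
    (t : Fin k → ℝ≥0) :
    intensity P' lam Y (∏ i, hit B (t i)) = ENNReal.ofReal (rho lam B * U P' B Y t) := by
  have hle : ∫⁻ ω, volume (⋂ i, shift B (Y (t i) ω)) ∂P' ≠ ∞ := by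
    refine ne_top_of_le_ne_top hB' ?_
    calc ∫⁻ ω, volume (⋂ i, shift B (Y (t i) ω)) ∂P' ≤ ∫⁻ _, volume B ∂P' :=
          lintegral_mono fun ω => volume_iInter_shift_le B _ 0
      _ = volume B := by simp
  have h0 : volume.real B ≠ 0 := (ENNReal.toReal_pos hB0 hB').ne'
  rw [intensity_prod_hit hB hY,
    ← ENNReal.ofReal_toReal (ENNReal.mul_ne_top ENNReal.coe_ne_top hle)]
  congr 1
  have hm := measurable_volume_iInter_shift hB hY t
  have h1 := (integrable_toReal_and_integral (μ := P') hm.aemeasurable rfl hle).2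
  rw [rho, U, ENNReal.toReal_mul, ENNReal.coe_toReal, ← h1]
  simp only [Measure.real] at h0 ⊢
  field_simp

/-- Fewer time points give a larger value of `U`. -/
theorem U_le_U_comp (hB : MeasurableSet B) (hB' : volume B ≠ ∞) (hY : ∀ t, Measurable (Y t))
    {k l : ℕ} [NeZero k] [NeZero l] (t : Fin k → ℝ≥0) (φ : Fin l → Fin k) :
    U P' B Y t ≤ U P' B Y (t ∘ φ) := by
  refine mul_le_mul_of_nonneg_left ?_ (by positivity)
  refine integral_mono (integrable_volume_iInter_shift hB hB' hY t)
    (integrable_volume_iInter_shift hB hB' hY _) fun ω => ?_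
  exact ENNReal.toReal_mono (ne_top_of_le_ne_top hB' (volume_iInter_shift_le B _ 0))
    (measure_mono fun x hx => Set.mem_iInter.2 fun i => Set.mem_iInter.1 hx (φ i))

theorem U_const (hB' : volume B ≠ ∞) (hB0 : volume B ≠ 0) {k : ℕ} [NeZero k] (s : ℝ≥0) :
    U P' B Y (fun _ : Fin k => s) = 1 := by
  have h0 : volume.real B ≠ 0 := (ENNReal.toReal_pos hB0 hB').ne'
  have : ∀ ω, volume.real (⋂ _ : Fin k, shift B (Y s ω)) = volume.real B := fun ω => by
    rw [Set.iInter_const, Measure.real, volume_shift, Measure.real]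
  simp only [U, this, integral_const, probReal_univ, one_smul]
  field_simp

theorem U_le_one (hB : MeasurableSet B) (hB' : volume B ≠ ∞) (hB0 : volume B ≠ 0)
    (hY : ∀ t, Measurable (Y t)) {k : ℕ} [NeZero k]
    (t : Fin k → ℝ≥0) : U P' B Y t ≤ 1 :=
  (U_le_U_comp hB hB' hY t (fun _ : Fin 1 => 0)).trans_eq (U_const hB' hB0 (t 0))

end Functionals

/-! ### Joint moments and central moments of `N`. -/

section Moments

variable {d : ℕ} {Ω Ω' : Type*} [MeasurableSpace Ω] [MeasurableSpace Ω'] {P : Measure Ω}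
  {P' : Measure Ω'} {lam : ℝ≥0} {B : Set (EuclideanSpace ℝ (Fin d))}
  {Y : ℝ≥0 → Ω' → EuclideanSpace ℝ (Fin d)} {ξ : ℤ → Ω → EuclideanSpace ℝ (Fin d)}
  {Yp : ℤ → ℝ≥0 → Ω → EuclideanSpace ℝ (Fin d)}

theorem IsParticleSystem.measurable_count (h : IsParticleSystem P P' lam Y ξ Yp)
    (hB : MeasurableSet B) (t : ℝ≥0) :
    Measurable fun ω => ∑' j, markedValue ξ Yp (hit B t) ω j :=
  Measurable.tsum fun j => h.measurable_markedValue (measurable_hit hB t) j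

variable [IsProbabilityMeasure P] [IsProbabilityMeasure P']

/-- The mean is constant in time by translation invariance of volume alone, without stationarity. -/
theorem IsParticleSystem.integral_N (h : IsParticleSystem P P' lam Y ξ Yp) (hl : 0 < lam)
    (hB : MeasurableSet B) (hB' : volume B ≠ ∞) (hB0 : volume B ≠ 0) (s : ℝ≥0) :
    Integrable (N B ξ Yp s) P ∧ ∫ ω, N B ξ Yp s ω ∂P = rho lam B := by
  have h1 := intensity_prod_hit_eq_ofReal (P' := P') (lam := lam) hB hB' hB0
    h.measurable_generic (fun _ : Fin 1 => s)
  rw [U_const hB' hB0, mul_one] at h1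
  simp only [Fin.prod_univ_one] at h1
  have h2 := integrable_toReal_and_integral (h.measurable_count hB s).aemeasurable
    (h.lintegral_tsum hl (measurable_hit hB s)) (by rw [h1]; finiteness)
  rwa [h1, ENNReal.toReal_ofReal rho_nonneg] at h2

theorem IsParticleSystem.integral_N_mul_N (h : IsParticleSystem P P' lam Y ξ Yp) (hl : 0 < lam)
    (hB : MeasurableSet B) (hB' : volume B ≠ ∞) (hB0 : volume B ≠ 0) (s t : ℝ≥0) :
    Integrable (fun ω => N B ξ Yp s ω * N B ξ Yp t ω) P ∧
      ∫ ω, N B ξ Yp s ω * N B ξ Yp t ω ∂P =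
        rho lam B ^ 2 + rho lam B * U P' B Y ![s, t] := by
  have hr : 0 ≤ rho lam B := rho_nonneg
  have h1 (s) := intensity_prod_hit_eq_ofReal (P' := P') (lam := lam) hB hB' hB0
    h.measurable_generic (fun _ : Fin 1 => s)
  have h2 (s t) := intensity_prod_hit_eq_ofReal (P' := P') (lam := lam) hB hB' hB0
    h.measurable_generic ![s, t]
  simp only [Fin.prod_univ_one, U_const hB' hB0, mul_one] at h1
  simp only [Fin.prod_univ_two, Matrix.cons_val] at h2
  have h3 := integrable_toReal_and_integral
    ((h.measurable_count hB s).mul (h.measurable_count hB t)).aemeasurable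
    (h.lintegral_tsum_mul_tsum hl (measurable_hit hB s) (measurable_hit hB t))
    (by simp only [h1, h2]; finiteness)
  simp (disch := first | assumption | exact mul_nonneg hr (U_nonneg _) | positivity |
      finiteness) only
    [ENNReal.toReal_add, ENNReal.toReal_mul, h1, h2, ENNReal.toReal_ofReal, Pi.mul_apply] at h3
  exact ⟨h3.1, h3.2.trans (by ring)⟩

theorem IsParticleSystem.integral_N_mul_N_mul_N (h : IsParticleSystem P P' lam Y ξ Yp)
    (hl : 0 < lam) (hB : MeasurableSet B) (hB' : volume B ≠ ∞) (hB0 : volume B ≠ 0)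
    (s t u : ℝ≥0) :
    Integrable (fun ω => N B ξ Yp s ω * (N B ξ Yp t ω * N B ξ Yp u ω)) P ∧
      ∫ ω, N B ξ Yp s ω * (N B ξ Yp t ω * N B ξ Yp u ω) ∂P =
        rho lam B ^ 3 + rho lam B ^ 2 * (U P' B Y ![s, t] + U P' B Y ![s, u] + U P' B Y ![t, u]) +
          rho lam B * U P' B Y ![s, t, u] := by
  have hr : 0 ≤ rho lam B := rho_nonneg
  have h1 (s) := intensity_prod_hit_eq_ofReal (P' := P') (lam := lam) hB hB' hB0
    h.measurable_generic (fun _ : Fin 1 => s)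
  have h2 (s t) := intensity_prod_hit_eq_ofReal (P' := P') (lam := lam) hB hB' hB0
    h.measurable_generic ![s, t]
  have h3 (s t u) := intensity_prod_hit_eq_ofReal (P' := P') (lam := lam) hB hB' hB0
    h.measurable_generic ![s, t, u]
  simp only [Fin.prod_univ_one, U_const hB' hB0, mul_one] at h1
  simp only [Fin.prod_univ_two, Matrix.cons_val] at h2
  simp only [Fin.prod_univ_three, Matrix.cons_val, mul_assoc (hit _ _)] at h3
  have h4 := integrable_toReal_and_integral
    ((h.measurable_count hB s).mul ((h.measurable_count hB t).mul
      (h.measurable_count hB u))).aemeasurable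
    (h.lintegral_tsum_mul_tsum_mul_tsum hl (measurable_hit hB s) (measurable_hit hB t)
      (measurable_hit hB u))
    (by simp only [h1, h2, h3]; finiteness)
  simp (disch := first | assumption | exact mul_nonneg hr (U_nonneg _) | positivity |
      finiteness) only
    [ENNReal.toReal_add, ENNReal.toReal_mul, h1, h2, h3, ENNReal.toReal_ofReal, Pi.mul_apply] at h4
  exact ⟨h4.1, h4.2.trans (by ring)⟩

theorem IsParticleSystem.integral_N_mul_N_mul_N_mul_N (h : IsParticleSystem P P' lam Y ξ Yp)
    (hl : 0 < lam) (hB : MeasurableSet B) (hB' : volume B ≠ ∞) (hB0 : volume B ≠ 0)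
    (s t u v : ℝ≥0) :
    Integrable (fun ω => N B ξ Yp s ω * (N B ξ Yp t ω * (N B ξ Yp u ω * N B ξ Yp v ω))) P ∧
      ∫ ω, N B ξ Yp s ω * (N B ξ Yp t ω * (N B ξ Yp u ω * N B ξ Yp v ω)) ∂P =
        rho lam B ^ 4 +
        rho lam B ^ 3 * (U P' B Y ![s, t] + U P' B Y ![s, u] + U P' B Y ![s, v] +
          U P' B Y ![t, u] + U P' B Y ![t, v] + U P' B Y ![u, v]) +
        rho lam B ^ 2 * (U P' B Y ![s, t] * U P' B Y ![u, v] +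
          U P' B Y ![s, u] * U P' B Y ![t, v] + U P' B Y ![s, v] * U P' B Y ![t, u]) +
        rho lam B ^ 2 * (U P' B Y ![t, u, v] + U P' B Y ![s, u, v] + U P' B Y ![s, t, v] +
          U P' B Y ![s, t, u]) +
        rho lam B * U P' B Y ![s, t, u, v] := by
  have hr : 0 ≤ rho lam B := rho_nonneg
  have h1 (s) := intensity_prod_hit_eq_ofReal (P' := P') (lam := lam) hB hB' hB0
    h.measurable_generic (fun _ : Fin 1 => s)
  have h2 (s t) := intensity_prod_hit_eq_ofReal (P' := P') (lam := lam) hB hB' hB0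
    h.measurable_generic ![s, t]
  have h3 (s t u) := intensity_prod_hit_eq_ofReal (P' := P') (lam := lam) hB hB' hB0
    h.measurable_generic ![s, t, u]
  have h4 (s t u v) := intensity_prod_hit_eq_ofReal (P' := P') (lam := lam) hB hB' hB0
    h.measurable_generic ![s, t, u, v]
  simp only [Fin.prod_univ_one, U_const hB' hB0, mul_one] at h1
  simp only [Fin.prod_univ_two, Matrix.cons_val] at h2
  simp only [Fin.prod_univ_three, Matrix.cons_val, mul_assoc (hit _ _)] at h3
  simp only [Fin.prod_univ_four, Matrix.cons_val, mul_assoc] at h4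
  have h5 := integrable_toReal_and_integral
    ((h.measurable_count hB s).mul ((h.measurable_count hB t).mul
      ((h.measurable_count hB u).mul (h.measurable_count hB v)))).aemeasurable
    (h.lintegral_tsum_mul_tsum_mul_tsum_mul_tsum hl (measurable_hit hB s) (measurable_hit hB t)
      (measurable_hit hB u) (measurable_hit hB v))
    (by simp only [h1, h2, h3, h4]; finiteness)
  simp (disch := first | assumption | exact mul_nonneg hr (U_nonneg _) | positivity |
      finiteness) only
    [ENNReal.toReal_add, ENNReal.toReal_mul, h1, h2, h3, h4, ENNReal.toReal_ofReal,
      Pi.mul_apply] at h5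
  exact ⟨h5.1, h5.2.trans (by ring)⟩

theorem integrable_add_and_integral {α : Type*} [MeasurableSpace α] {μ : Measure α} {f g : α → ℝ}
    {u v : ℝ} (hf : Integrable f μ ∧ ∫ a, f a ∂μ = u) (hg : Integrable g μ ∧ ∫ a, g a ∂μ = v) :
    Integrable (fun a => f a + g a) μ ∧ ∫ a, f a + g a ∂μ = u + v :=
  ⟨hf.1.add hg.1, by rw [integral_add hf.1 hg.1, hf.2, hg.2]⟩

theorem integrable_const_mul_and_integral {α : Type*} [MeasurableSpace α] {μ : Measure α}
    {f : α → ℝ} {u : ℝ} (c : ℝ) (hf : Integrable f μ ∧ ∫ a, f a ∂μ = u) :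
    Integrable (fun a => c * f a) μ ∧ ∫ a, c * f a ∂μ = c * u :=
  ⟨hf.1.const_mul c, by rw [integral_const_mul, hf.2]⟩

/-- The covariance function of the Smoluchowski process. -/
theorem IsParticleSystem.integral_centered_mul (h : IsParticleSystem P P' lam Y ξ Yp)
    (hl : 0 < lam) (hB : MeasurableSet B) (hB' : volume B ≠ ∞) (hB0 : volume B ≠ 0)
    (s t : ℝ≥0) :
    Integrable (fun ω => (N B ξ Yp s ω - rho lam B) * (N B ξ Yp t ω - rho lam B)) P ∧
      ∫ ω, (N B ξ Yp s ω - rho lam B) * (N B ξ Yp t ω - rho lam B) ∂P =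
        rho lam B * U P' B Y ![s, t] := by
  have h0 : Integrable (fun _ : Ω => (1 : ℝ)) P ∧ ∫ _, (1 : ℝ) ∂P = 1 :=
    ⟨integrable_const _, by simp⟩
  have h1 := h.integral_N hl hB hB' hB0
  have h2 := integrable_add_and_integral (integrable_add_and_integral
    (h.integral_N_mul_N hl hB hB' hB0 s t)
    (integrable_const_mul_and_integral (-rho lam B) (integrable_add_and_integral (h1 s) (h1 t))))
    (integrable_const_mul_and_integral (rho lam B ^ 2) h0)
  have he : (fun ω => (N B ξ Yp s ω - rho lam B) * (N B ξ Yp t ω - rho lam B)) = fun ω =>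
      N B ξ Yp s ω * N B ξ Yp t ω + -rho lam B * (N B ξ Yp s ω + N B ξ Yp t ω) +
        rho lam B ^ 2 * 1 := by
    ext ω
    ring
  rw [he]
  exact ⟨h2.1, h2.2.trans (by ring)⟩

/-- The fourth order joint central moments of the Smoluchowski process. -/
theorem IsParticleSystem.integral_centered_mul_four (h : IsParticleSystem P P' lam Y ξ Yp)
    (hl : 0 < lam) (hB : MeasurableSet B) (hB' : volume B ≠ ∞) (hB0 : volume B ≠ 0)
    (s t u v : ℝ≥0) :
    Integrable (fun ω => (N B ξ Yp s ω - rho lam B) * (N B ξ Yp t ω - rho lam B) *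
        ((N B ξ Yp u ω - rho lam B) * (N B ξ Yp v ω - rho lam B))) P ∧
      ∫ ω, (N B ξ Yp s ω - rho lam B) * (N B ξ Yp t ω - rho lam B) *
        ((N B ξ Yp u ω - rho lam B) * (N B ξ Yp v ω - rho lam B)) ∂P =
        rho lam B ^ 2 * (U P' B Y ![s, t] * U P' B Y ![u, v] +
          U P' B Y ![s, u] * U P' B Y ![t, v] + U P' B Y ![s, v] * U P' B Y ![t, u]) +
        rho lam B * U P' B Y ![s, t, u, v] := by
  have h0 : Integrable (fun _ : Ω => (1 : ℝ)) P ∧ ∫ _, (1 : ℝ) ∂P = 1 :=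
    ⟨integrable_const _, by simp⟩
  have h1 := h.integral_N hl hB hB' hB0
  have h2 := h.integral_N_mul_N hl hB hB' hB0
  have h3 := h.integral_N_mul_N_mul_N hl hB hB' hB0
  have h4 := h.integral_N_mul_N_mul_N_mul_N hl hB hB' hB0 s t u v
  -- The centered product is expanded over subsets of the four factors, with coefficients `(-ρ)` to
  -- the number of omitted factors. All partitions with a singleton block cancel, including those of
  -- type 3+1.
  have h5 := integrable_add_and_integral (integrable_add_and_integral (integrable_add_and_integral
    (integrable_add_and_integral h4
    (integrable_const_mul_and_integral (-rho lam B) (integrable_add_and_integral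
      (integrable_add_and_integral (h3 s t u) (h3 s t v))
      (integrable_add_and_integral (h3 s u v) (h3 t u v)))))
    (integrable_const_mul_and_integral (rho lam B ^ 2) (integrable_add_and_integral
      (integrable_add_and_integral (integrable_add_and_integral (h2 s t) (h2 s u)) (h2 s v))
      (integrable_add_and_integral (integrable_add_and_integral (h2 t u) (h2 t v)) (h2 u v)))))
    (integrable_const_mul_and_integral (-rho lam B ^ 3) (integrable_add_and_integral
      (integrable_add_and_integral (h1 s) (h1 t)) (integrable_add_and_integral (h1 u) (h1 v)))))
    (integrable_const_mul_and_integral (rho lam B ^ 4) h0)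
  refine ⟨h5.1.congr (Filter.Eventually.of_forall fun ω => by ring), ?_⟩
  refine (integral_congr_ae (Filter.Eventually.of_forall fun ω => ?_)).trans
    (h5.2.trans ?_)
  · ring
  · ring

/-- Up to the nonzero factor `ρ`, `U` at two times is a covariance of `N`. Stationarity is assumed
of `N`, not of the increments of `Y`, so shift invariance of `U` is read off from that covariance.
-/
theorem IsParticleSystem.U_eq_H (h : IsParticleSystem P P' lam Y ξ Yp) (hl : 0 < lam)
    (hB : MeasurableSet B) (hB' : volume B ≠ ∞) (hB0 : volume B ≠ 0)
    (hs : IsStrictlyStationary P (N B ξ Yp)) (a b : ℝ≥0) :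
    U P' B Y ![a, b] = H P' B Y (a - b) := by
  have hrho : rho lam B ≠ 0 :=
    mul_ne_zero (by exact_mod_cast hl.ne') (ENNReal.toReal_pos hB0 hB').ne'
  have hc := fun s t => (h.integral_centered_mul hl hB hB' hB0 s t).2
  have hshift : ∀ s t τ : ℝ≥0, U P' B Y ![s + τ, t + τ] = U P' B Y ![s, t] := by
    intro s t τ
    have h1 := (hs 2 ![s, t] τ).comp (u := fun x : Fin 2 → ℝ =>
      (x 0 - rho lam B) * (x 1 - rho lam B)) (by fun_prop)
    have h2 := h1.integral_eq
    simp only [Function.comp_def, Matrix.cons_val_zero, Matrix.cons_val_one, hc] at h2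
    exact mul_left_cancel₀ hrho h2
  have hsymm : ∀ s t : ℝ≥0, U P' B Y ![s, t] = U P' B Y ![t, s] := by
    intro s t
    refine mul_left_cancel₀ hrho ?_
    rw [← hc, ← hc]
    exact integral_congr_ae (Filter.Eventually.of_forall fun ω => mul_comm _ _)
  have hle : ∀ s t : ℝ≥0, s ≤ t → U P' B Y ![s, t] = H P' B Y (s - t) := by
    intro s t hst
    rw [H_eq_U h.generic_zero]
    have : Real.nnabs (s - t : ℝ) = t - s := by
      ext
      rw [Real.coe_nnabs, NNReal.coe_sub hst, abs_sub_comm, abs_of_nonneg]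
      exact sub_nonneg.2 hst
    have h2 := hshift 0 (t - s) s
    rwa [zero_add, tsub_add_cancel_of_le hst, ← this] at h2
  rcases le_total a b with hab | hab
  · exact hle a b hab
  · rw [hsymm, hle b a hab, H_eq_U h.generic_zero, H_eq_U h.generic_zero]
    congr 2
    ext
    simp [abs_sub_comm]

end Moments

/-! ### Fubini for products of two path integrals. -/

section General

variable {α β Ω : Type*} [MeasurableSpace α] [MeasurableSpace β] [MeasurableSpace Ω]
  {μ : Measure α} {ν : Measure β} {P : Measure Ω}

theorem integrable_prod_of_bound [IsFiniteMeasure μ] [SFinite P] {f : α × Ω → ℝ}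
    (hf : AEStronglyMeasurable f (μ.prod P)) {C : ℝ}
    (h : ∀ x, Integrable (fun ω => f (x, ω)) P ∧ ∫ ω, ‖f (x, ω)‖ ∂P ≤ C) :
    Integrable f (μ.prod P) := by
  refine (integrable_prod_iff hf).2 ⟨Filter.Eventually.of_forall fun x => (h x).1, ?_⟩
  refine Integrable.of_bound (C := C) hf.norm.integral_prod_right' ?_
  refine Filter.Eventually.of_forall fun x => ?_
  rw [Real.norm_of_nonneg (integral_nonneg fun ω => norm_nonneg _)]
  exact (h x).2

/-- Each projection sends the triple product to a finite multiple of the corresponding double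
product. Both factors therefore stay square integrable, and Hölder applies. -/
theorem integrable_prod_mul_of_memLp_two [IsFiniteMeasure μ] [IsFiniteMeasure ν] [SFinite P]
    {f : α × Ω → ℝ} {g : β × Ω → ℝ} (hf : MemLp f 2 (μ.prod P)) (hg : MemLp g 2 (ν.prod P)) :
    Integrable (fun p : (α × β) × Ω => f (p.1.1, p.2) * g (p.1.2, p.2))
      ((μ.prod ν).prod P) := by
  have h1 : ((μ.prod ν).prod P).map (Prod.map Prod.fst id) = ν Set.univ • μ.prod P := by
    rw [← Measure.map_prod_map _ _ measurable_fst measurable_id, Measure.map_id,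
      Measure.map_fst_prod, Measure.prod_smul_left]
  have h2 : ((μ.prod ν).prod P).map (Prod.map Prod.snd id) = μ Set.univ • ν.prod P := by
    rw [← Measure.map_prod_map _ _ measurable_snd measurable_id, Measure.map_id,
      Measure.map_snd_prod, Measure.prod_smul_left]
  have hf' := hf.smul_measure (measure_ne_top ν Set.univ)
  have hg' := hg.smul_measure (measure_ne_top μ Set.univ)
  rw [← h1] at hf'
  rw [← h2] at hg'
  exact (hf'.comp_of_map (measurable_fst.prodMap measurable_id).aemeasurable).integrable_mul
    (hg'.comp_of_map (measurable_snd.prodMap measurable_id).aemeasurable)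

theorem integral_integral_mul_integral [IsFiniteMeasure μ] [IsFiniteMeasure ν] [SFinite P]
    {f : α × Ω → ℝ} {g : β × Ω → ℝ} (hf : MemLp f 2 (μ.prod P)) (hg : MemLp g 2 (ν.prod P)) :
    Integrable (fun ω => (∫ x, f (x, ω) ∂μ) * ∫ y, g (y, ω) ∂ν) P ∧
      Integrable (fun z : α × β => ∫ ω, f (z.1, ω) * g (z.2, ω) ∂P) (μ.prod ν) ∧
      ∫ ω, (∫ x, f (x, ω) ∂μ) * ∫ y, g (y, ω) ∂ν ∂P =
        ∫ z, ∫ ω, f (z.1, ω) * g (z.2, ω) ∂P ∂μ.prod ν := by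
  have h := integrable_prod_mul_of_memLp_two hf hg
  refine ⟨?_, h.integral_prod_left, ?_⟩
  · refine h.integral_prod_right.congr (Filter.Eventually.of_forall fun ω => ?_)
    exact integral_prod_mul (fun x => f (x, ω)) fun y => g (y, ω)
  · rw [integral_integral_swap h]
    exact integral_congr_ae (Filter.Eventually.of_forall fun ω =>
      (integral_prod_mul (fun x => f (x, ω)) fun y => g (y, ω)).symm)

end General

/-! ### Measurability of `H` and square integrability of the empirical integrand. -/

section Particles

variable {d : ℕ} {Ω Ω' : Type*} [MeasurableSpace Ω] [MeasurableSpace Ω'] {P : Measure Ω}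
  {P' : Measure Ω'} {lam : ℝ≥0} {B : Set (EuclideanSpace ℝ (Fin d))}
  {Y : ℝ≥0 → Ω' → EuclideanSpace ℝ (Fin d)} {ξ : ℤ → Ω → EuclideanSpace ℝ (Fin d)}
  {Yp : ℤ → ℝ≥0 → Ω → EuclideanSpace ℝ (Fin d)}

theorem H_neg (x : ℝ) : H P' B Y (-x) = H P' B Y x := by
  have : Real.nnabs (-x) = Real.nnabs x := by
    ext
    simp
  rw [H, H, this]

theorem H_mem_Icc [IsProbabilityMeasure P'] (hB : MeasurableSet B)
    (hB' : volume B ≠ ∞) (hB0 : volume B ≠ 0)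
    (hY : ∀ t, Measurable (Y t)) (hY0 : ∀ᵐ ω ∂P', Y 0 ω = 0) (x : ℝ) :
    H P' B Y x ∈ Set.Icc (0 : ℝ) 1 := by
  rw [H_eq_U hY0]
  exact ⟨U_nonneg _, U_le_one hB hB' hB0 hY _⟩

variable [IsProbabilityMeasure P] [IsProbabilityMeasure P']

theorem aestronglyMeasurable_empIntegrand
    (hN : AEMeasurable (fun p : ℝ × Ω => N B ξ Yp p.1.toNNReal p.2) (volume.prod P)) (m t : ℝ) :
    AEStronglyMeasurable (fun p : ℝ × Ω => empIntegrand (N B ξ Yp) m t p.2 p.1)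
      (volume.prod P) := by
  have h1 : Measure.QuasiMeasurePreserving (Prod.map (fun u : ℝ => t + u) (id : Ω → Ω))
      (volume.prod P) (volume.prod P) :=
    ((measurePreserving_add_left volume t).prod (.id P)).quasiMeasurePreserving
  exact ((hN.sub_const m).mul
    ((hN.comp_quasiMeasurePreserving h1).sub_const m)).aestronglyMeasurable

/-- No measurability of `Y` in time is assumed, so it comes from `N`: writing `x = x⁺ - x⁻`, the
value `ρ H(x)` is the covariance of `N(x⁺)` and `N(x⁻)`, an integral over `Ω` of a jointly
measurable function. -/
theorem IsParticleSystem.aestronglyMeasurable_H (h : IsParticleSystem P P' lam Y ξ Yp)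
    (hl : 0 < lam) (hB : MeasurableSet B) (hB' : volume B ≠ ∞) (hB0 : volume B ≠ 0)
    (hN : AEMeasurable (fun p : ℝ × Ω => N B ξ Yp p.1.toNNReal p.2) (volume.prod P))
    (hs : IsStrictlyStationary P (N B ξ Yp)) :
    AEStronglyMeasurable (H P' B Y) volume := by
  have hrho : rho lam B ≠ 0 :=
    mul_ne_zero (by exact_mod_cast hl.ne') (ENNReal.toReal_pos hB0 hB').ne'
  have h1 : Measure.QuasiMeasurePreserving (Prod.map (fun u : ℝ => -u) (id : Ω → Ω))
      (volume.prod P) (volume.prod P) :=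
    ((Measure.measurePreserving_neg (volume : Measure ℝ)).prod (.id P)).quasiMeasurePreserving
  have h2 : AEStronglyMeasurable (fun p : ℝ × Ω => (N B ξ Yp p.1.toNNReal p.2 - rho lam B) *
      (N B ξ Yp (-p.1).toNNReal p.2 - rho lam B)) (volume.prod P) :=
    ((hN.sub_const _).mul
      ((hN.comp_quasiMeasurePreserving h1).sub_const _)).aestronglyMeasurable
  have h3 := h2.integral_prod_right'.const_mul (rho lam B)⁻¹
  refine h3.congr (Filter.Eventually.of_forall fun x => ?_)
  have h4 := (h.integral_centered_mul hl hB hB' hB0 x.toNNReal (-x).toNNReal).2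
  have h5 : ((x.toNNReal : ℝ) - (-x).toNNReal) = x := by
    simp only [Real.coe_toNNReal']
    rcases le_total x 0 with hx | hx <;> simp [hx]
  simp only [h4, h.U_eq_H hl hB hB' hB0 hs, h5]
  field_simp

theorem IsParticleSystem.R_eq (h : IsParticleSystem P P' lam Y ξ Yp) (hl : 0 < lam)
    (hB : MeasurableSet B) (hB' : volume B ≠ ∞) (hB0 : volume B ≠ 0) {t : ℝ} (ht : 0 ≤ t) :
    R P (N B ξ Yp) t = rho lam B * H P' B Y t := by
  rw [R, covariance, (h.integral_N hl hB hB' hB0 _).2, (h.integral_N hl hB hB' hB0 _).2,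
    (h.integral_centered_mul hl hB hB' hB0 _ _).2, H_eq_U h.generic_zero,
    Real.nnabs_of_nonneg ht]

/-- The integrand of the error of the empirical covariance is square integrable. -/
theorem IsParticleSystem.memLp_empIntegrand_sub (h : IsParticleSystem P P' lam Y ξ Yp)
    (hl : 0 < lam) (hB : MeasurableSet B) (hB' : volume B ≠ ∞) (hB0 : volume B ≠ 0)
    (hN : AEMeasurable (fun p : ℝ × Ω => N B ξ Yp p.1.toNNReal p.2) (volume.prod P))
    (t c : ℝ) {A : Set ℝ} (hA : volume A ≠ ∞) :
    MemLp (fun p : ℝ × Ω => empIntegrand (N B ξ Yp) (rho lam B) t p.2 p.1 - c) 2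
      ((volume.restrict A).prod P) := by
  have : IsFiniteMeasure (volume.restrict A) := ⟨by simpa using hA.lt_top⟩
  have hm : AEStronglyMeasurable (fun p : ℝ × Ω => empIntegrand (N B ξ Yp) (rho lam B) t p.2 p.1)
      ((volume.restrict A).prod P) :=
    (aestronglyMeasurable_empIntegrand hN _ t).mono_ac
      (Measure.restrict_le_self.absolutelyContinuous.prod .rfl)
  refine MemLp.sub ((memLp_two_iff_integrable_sq hm).2 ?_) (memLp_const c)
  -- The constant is the fourth central moment with every value of `U` replaced by its bound one.
  refine integrable_prod_of_bound (C := rho lam B ^ 2 * (1 * 1 + 1 * 1 + 1 * 1) + rho lam B * 1)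
    (hm.pow 2) fun x => ?_
  have h1 := h.integral_centered_mul_four hl hB hB' hB0 x.toNNReal (t + x).toNNReal
    x.toNNReal (t + x).toNNReal
  simp only [empIntegrand, sq (_ * _)]
  refine ⟨h1.1, ?_⟩
  rw [integral_congr_ae (Filter.Eventually.of_forall fun ω => Real.norm_of_nonneg
    (mul_self_nonneg _)), h1.2]
  have hU {k : ℕ} [NeZero k] (t : Fin k → ℝ≥0) :=
    U_le_one (P' := P') hB hB' hB0 h.measurable_generic t
  have hr : 0 ≤ rho lam B := rho_nonneg
  gcongr <;> first | exact hU _ | exact U_nonneg _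

end Particles

/-! ### The covariance of the errors. -/

section Particles

variable {d : ℕ} {Ω Ω' : Type*} [MeasurableSpace Ω] [MeasurableSpace Ω'] {P : Measure Ω}
  [IsProbabilityMeasure P]
  {P' : Measure Ω'} [IsProbabilityMeasure P'] {lam : ℝ≥0} {B : Set (EuclideanSpace ℝ (Fin d))}
  {Y : ℝ≥0 → Ω' → EuclideanSpace ℝ (Fin d)} {ξ : ℤ → Ω → EuclideanSpace ℝ (Fin d)}
  {Yp : ℤ → ℝ≥0 → Ω → EuclideanSpace ℝ (Fin d)}

/-- Almost surely, the empirical covariance is a well defined integral, and its error is the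
normalised integral of the centered integrand. -/
theorem IsParticleSystem.Rhat_sub_R (h : IsParticleSystem P P' lam Y ξ Yp) (hl : 0 < lam)
    (hB : MeasurableSet B) (hB' : volume B ≠ ∞) (hB0 : volume B ≠ 0)
    (hN : AEMeasurable (fun p : ℝ × Ω => N B ξ Yp p.1.toNNReal p.2) (volume.prod P))
    {t T : ℝ} (htT : t < T) :
    ∀ᵐ ω ∂P, IntervalIntegrable (empIntegrand (N B ξ Yp) (rho lam B) t ω) volume 0 (T - t) ∧
      (T - t) * (Rhat (N B ξ Yp) (rho lam B) T t ω - R P (N B ξ Yp) t) =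
        ∫ u in Set.Icc 0 (T - t),
          (empIntegrand (N B ξ Yp) (rho lam B) t ω u - R P (N B ξ Yp) t) := by
  have hpos : 0 < T - t := sub_pos.2 htT
  have h1 := (h.memLp_empIntegrand_sub hl hB hB' hB0 hN t 0
    (A := Set.Icc 0 (T - t)) (by simp)).integrable one_le_two
  filter_upwards [h1.prod_left_ae] with ω hω
  simp only [sub_zero] at hω
  have h2 : IntervalIntegrable (empIntegrand (N B ξ Yp) (rho lam B) t ω) volume 0 (T - t) :=
    (intervalIntegrable_iff_integrableOn_Icc_of_le hpos.le).2 hω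
  refine ⟨h2, ?_⟩
  rw [integral_sub hω (integrable_const _), Rhat, intervalIntegral.integral_of_le hpos.le,
    ← integral_Icc_eq_integral_Ioc]
  simp [hpos.le]
  field_simp

theorem integrable_H_comp (hB : MeasurableSet B) (hB' : volume B ≠ ∞) (hB0 : volume B ≠ 0)
    (hY : ∀ t, Measurable (Y t)) (hY0 : ∀ᵐ ω ∂P', Y 0 ω = 0)
    (hH : AEStronglyMeasurable (H P' B Y) volume) {α : Type*} [MeasurableSpace α] {μ : Measure α}
    [IsFiniteMeasure μ] {φ : α → ℝ} (hφ : Measure.QuasiMeasurePreserving φ μ volume) :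
    Integrable (fun x => H P' B Y (φ x)) μ :=
  Integrable.of_bound (C := 1) (hH.comp_quasiMeasurePreserving hφ)
    (Filter.Eventually.of_forall fun x => by
      have := H_mem_Icc hB hB' hB0 hY hY0 (φ x)
      rw [Real.norm_of_nonneg this.1]
      exact this.2)

theorem intervalIntegrable_H (hB : MeasurableSet B) (hB' : volume B ≠ ∞) (hB0 : volume B ≠ 0)
    (hY : ∀ t, Measurable (Y t)) (hY0 : ∀ᵐ ω ∂P', Y 0 ω = 0)
    (hH : AEStronglyMeasurable (H P' B Y) volume) (a b : ℝ) :
    IntervalIntegrable (H P' B Y) volume a b := by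
  rw [intervalIntegrable_iff]
  have : IsFiniteMeasure (volume.restrict (Set.uIoc a b)) := ⟨by simp [Set.uIoc]⟩
  exact integrable_H_comp hB hB' hB0 hY hY0 hH (φ := id)
    ⟨measurable_id, by simpa using Measure.restrict_le_self.absolutelyContinuous⟩

theorem quasiMeasurePreserving_sub_add (c : ℝ) (A : Set (ℝ × ℝ)) :
    Measure.QuasiMeasurePreserving (fun τ : ℝ × ℝ => τ.1 - τ.2 + c) (volume.restrict A)
      volume :=
  ((measurePreserving_add_right volume c).quasiMeasurePreserving.comp
    (quasiMeasurePreserving_sub_of_right_invariant volume volume)).mono_left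
    Measure.restrict_le_self.absolutelyContinuous

theorem integrable_H_mul_H (hB : MeasurableSet B) (hB' : volume B ≠ ∞) (hB0 : volume B ≠ 0)
    (hY : ∀ t, Measurable (Y t)) (hY0 : ∀ᵐ ω ∂P', Y 0 ω = 0)
    (hH : AEStronglyMeasurable (H P' B Y) volume) (a b : ℝ) {A : Set (ℝ × ℝ)}
    (hA : volume A ≠ ∞) :
    Integrable (fun τ : ℝ × ℝ => H P' B Y (τ.1 - τ.2 + a) * H P' B Y (τ.1 - τ.2 + b))
      (volume.restrict A) := by
  have : IsFiniteMeasure (volume.restrict A) := ⟨by simpa using hA.lt_top⟩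
  refine (integrable_H_comp hB hB' hB0 hY hY0 hH (quasiMeasurePreserving_sub_add a A)).mul_bdd
    (c := 1) (integrable_H_comp hB hB' hB0 hY hY0 hH
      (quasiMeasurePreserving_sub_add b A)).aestronglyMeasurable
    (Filter.Eventually.of_forall fun x => ?_)
  have := H_mem_Icc hB hB' hB0 hY hY0 (x.1 - x.2 + b)
  rw [Real.norm_of_nonneg this.1]
  exact this.2

/-- Centering contributes `-2 R(t) R(s) + R(t) R(s)`, which cancels the pairing of each time with
its own lag, `ρ² H(t) H(s)`. -/
theorem IsParticleSystem.integral_error_mul_error (h : IsParticleSystem P P' lam Y ξ Yp)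
    (hl : 0 < lam) (hB : MeasurableSet B) (hB' : volume B ≠ ∞) (hB0 : volume B ≠ 0)
    (hs : IsStrictlyStationary P (N B ξ Yp)) {t s : ℝ} (ht : 0 ≤ t) (hs0 : 0 ≤ s)
    {x y : ℝ} (hx : 0 ≤ x) (hy : 0 ≤ y) :
    ∫ ω, (empIntegrand (N B ξ Yp) (rho lam B) t ω x - R P (N B ξ Yp) t) *
        (empIntegrand (N B ξ Yp) (rho lam B) s ω y - R P (N B ξ Yp) s) ∂P =
      rho lam B ^ 2 * (H P' B Y (x - y) * H P' B Y (x - y + t - s) +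
        H P' B Y (x - y - s) * H P' B Y (x - y + t)) +
      rho lam B * U P' B Y ![x.toNNReal, (x + t).toNNReal, y.toNNReal, (y + s).toNNReal] := by
  have h0 : Integrable (fun _ : Ω => (1 : ℝ)) P ∧ ∫ _, (1 : ℝ) ∂P = 1 :=
    ⟨integrable_const _, by simp⟩
  have h1 := h.integral_centered_mul_four hl hB hB' hB0 x.toNNReal (x + t).toNNReal
    y.toNNReal (y + s).toNNReal
  have h2 := h.integral_centered_mul hl hB hB' hB0 x.toNNReal (x + t).toNNReal
  have h3 := h.integral_centered_mul hl hB hB' hB0 y.toNNReal (y + s).toNNReal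
  have h4 := integrable_add_and_integral (integrable_add_and_integral (integrable_add_and_integral
    h1 (integrable_const_mul_and_integral (-R P (N B ξ Yp) s) h2))
    (integrable_const_mul_and_integral (-R P (N B ξ Yp) t) h3))
    (integrable_const_mul_and_integral (R P (N B ξ Yp) t * R P (N B ξ Yp) s) h0)
  refine (integral_congr_ae (Filter.Eventually.of_forall fun ω => ?_)).trans (h4.2.trans ?_)
  · simp only [empIntegrand, add_comm t x, add_comm s y]
    ring
  · have e1 : x - (x + t) = -t := by ring
    have e2 : y - (y + s) = -s := by ring
    have e3 : x - (y + s) = x - y - s := by ring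
    have e4 : x + t - (y + s) = x - y + t - s := by ring
    have e5 : x + t - y = x - y + t := by ring
    simp only [h.R_eq hl hB hB' hB0 ht, h.R_eq hl hB hB' hB0 hs0, h.U_eq_H hl hB hB' hB0 hs,
      Real.coe_toNNReal _ hx, Real.coe_toNNReal _ hy, Real.coe_toNNReal _ (add_nonneg hx ht),
      Real.coe_toNNReal _ (add_nonneg hy hs0), e1, e2, e3, e4, e5, H_neg]
    ring

theorem integrableOn_H_mul_H_add (hB : MeasurableSet B) (hB' : volume B ≠ ∞) (hB0 : volume B ≠ 0)
    (hY : ∀ t, Measurable (Y t)) (hY0 : ∀ᵐ ω ∂P', Y 0 ω = 0)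
    (hH : AEStronglyMeasurable (H P' B Y) volume) (t s : ℝ) {A : Set (ℝ × ℝ)}
    (hA : volume A ≠ ∞) :
    IntegrableOn (fun τ : ℝ × ℝ => H P' B Y (τ.1 - τ.2) * H P' B Y (τ.1 - τ.2 + t - s) +
      H P' B Y (τ.1 - τ.2 - s) * H P' B Y (τ.1 - τ.2 + t)) A volume := by
  refine ((integrable_H_mul_H hB hB' hB0 hY hY0 hH 0 (t - s) hA).add
    (integrable_H_mul_H hB hB' hB0 hY hY0 hH (-s) t hA)).congr
    (Filter.Eventually.of_forall fun τ => ?_)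
  simp only [Pi.add_apply, add_zero, add_sub_assoc, ← sub_eq_add_neg]

/-- Square integrability of the error of the empirical covariance, and the covariance of two
errors as an integral over the square. -/
theorem IsParticleSystem.covariance_error (h : IsParticleSystem P P' lam Y ξ Yp)
    (hl : 0 < lam) (hB : MeasurableSet B) (hB' : volume B ≠ ∞) (hB0 : volume B ≠ 0)
    (hN : AEMeasurable (fun p : ℝ × Ω => N B ξ Yp p.1.toNNReal p.2) (volume.prod P))
    (hs : IsStrictlyStationary P (N B ξ Yp)) {t s T : ℝ} (ht : 0 ≤ t) (htT : t < T)
    (hs0 : 0 ≤ s) (hsT : s < T) :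
    Integrable (fun ω => (Rhat (N B ξ Yp) (rho lam B) T t ω - R P (N B ξ Yp) t) *
        (Rhat (N B ξ Yp) (rho lam B) T s ω - R P (N B ξ Yp) s)) P ∧
      IntegrableOn (fun τ : ℝ × ℝ =>
        U P' B Y ![τ.1.toNNReal, (τ.1 + t).toNNReal, τ.2.toNNReal, (τ.2 + s).toNNReal])
        (Set.Icc 0 (T - t) ×ˢ Set.Icc 0 (T - s)) volume ∧
      (T - s) * (T - t) *
        ∫ ω, (Rhat (N B ξ Yp) (rho lam B) T t ω - R P (N B ξ Yp) t) *
          (Rhat (N B ξ Yp) (rho lam B) T s ω - R P (N B ξ Yp) s) ∂P =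
        rho lam B ^ 2 * (∫ τ in Set.Icc 0 (T - t) ×ˢ Set.Icc 0 (T - s),
          (H P' B Y (τ.1 - τ.2) * H P' B Y (τ.1 - τ.2 + t - s) +
            H P' B Y (τ.1 - τ.2 - s) * H P' B Y (τ.1 - τ.2 + t))) +
        rho lam B * ∫ τ in Set.Icc 0 (T - t) ×ˢ Set.Icc 0 (T - s),
          U P' B Y ![τ.1.toNNReal, (τ.1 + t).toNNReal, τ.2.toNNReal, (τ.2 + s).toNNReal] := by
  have hrho : rho lam B ≠ 0 :=
    mul_ne_zero (by exact_mod_cast hl.ne') (ENNReal.toReal_pos hB0 hB').ne'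
  have ht' : 0 < T - t := sub_pos.2 htT
  have hs' : 0 < T - s := sub_pos.2 hsT
  have hmeas : MeasurableSet (Set.Icc 0 (T - t) ×ˢ Set.Icc 0 (T - s)) :=
    measurableSet_Icc.prod measurableSet_Icc
  have hHH : IntegrableOn (fun τ : ℝ × ℝ => H P' B Y (τ.1 - τ.2) * H P' B Y (τ.1 - τ.2 + t - s) +
      H P' B Y (τ.1 - τ.2 - s) * H P' B Y (τ.1 - τ.2 + t))
      (Set.Icc 0 (T - t) ×ˢ Set.Icc 0 (T - s)) volume :=
    integrableOn_H_mul_H_add hB hB' hB0 h.measurable_generic h.generic_zero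
      (h.aestronglyMeasurable_H hl hB hB' hB0 hN hs) t s
      (isCompact_Icc.prod isCompact_Icc).measure_ne_top
  have : IsFiniteMeasure (volume.restrict (Set.Icc 0 (T - t))) := ⟨by simp⟩
  have : IsFiniteMeasure (volume.restrict (Set.Icc 0 (T - s))) := ⟨by simp⟩
  obtain ⟨h1, h2, h3⟩ := integral_integral_mul_integral
    (h.memLp_empIntegrand_sub hl hB hB' hB0 hN t (R P (N B ξ Yp) t)
      (A := Set.Icc 0 (T - t)) (by simp))
    (h.memLp_empIntegrand_sub hl hB hB' hB0 hN s (R P (N B ξ Yp) s)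
      (A := Set.Icc 0 (T - s)) (by simp))
  rw [Measure.prod_restrict, ← Measure.volume_eq_prod] at h2 h3
  have hD : (fun ω => (∫ x in Set.Icc 0 (T - t),
        (empIntegrand (N B ξ Yp) (rho lam B) t ω x - R P (N B ξ Yp) t)) *
        ∫ y in Set.Icc 0 (T - s),
          (empIntegrand (N B ξ Yp) (rho lam B) s ω y - R P (N B ξ Yp) s)) =ᵐ[P] fun ω =>
      (T - s) * (T - t) * ((Rhat (N B ξ Yp) (rho lam B) T t ω - R P (N B ξ Yp) t) *
        (Rhat (N B ξ Yp) (rho lam B) T s ω - R P (N B ξ Yp) s)) := by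
    filter_upwards [h.Rhat_sub_R hl hB hB' hB0 hN htT, h.Rhat_sub_R hl hB hB' hB0 hN hsT]
      with ω hω1 hω2
    rw [← hω1.2, ← hω2.2]
    ring
  -- The formula is claimed only on the rectangle, where all times are nonnegative and `toNNReal`
  -- truncates nothing.
  have hE : Set.EqOn (fun τ : ℝ × ℝ =>
      ∫ ω, (empIntegrand (N B ξ Yp) (rho lam B) t ω τ.1 - R P (N B ξ Yp) t) *
        (empIntegrand (N B ξ Yp) (rho lam B) s ω τ.2 - R P (N B ξ Yp) s) ∂P)
      (fun τ => rho lam B ^ 2 * (H P' B Y (τ.1 - τ.2) * H P' B Y (τ.1 - τ.2 + t - s) +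
        H P' B Y (τ.1 - τ.2 - s) * H P' B Y (τ.1 - τ.2 + t)) +
      rho lam B * U P' B Y ![τ.1.toNNReal, (τ.1 + t).toNNReal, τ.2.toNNReal, (τ.2 + s).toNNReal])
      (Set.Icc 0 (T - t) ×ˢ Set.Icc 0 (T - s)) := fun τ hτ =>
    h.integral_error_mul_error hl hB hB' hB0 hs ht hs0 hτ.1.1 hτ.2.1
  -- Integrability of the four-point term is obtained by subtraction: Fubini gives it for the whole
  -- expectation, boundedness for the `H` part, and `ρ ≠ 0` allows division.
  have hU : IntegrableOn (fun τ : ℝ × ℝ =>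
      U P' B Y ![τ.1.toNNReal, (τ.1 + t).toNNReal, τ.2.toNNReal, (τ.2 + s).toNNReal])
      (Set.Icc 0 (T - t) ×ˢ Set.Icc 0 (T - s)) volume := by
    have h4 := ((IntegrableOn.congr_fun h2 hE hmeas).sub
      (hHH.const_mul (rho lam B ^ 2))).const_mul (rho lam B)⁻¹
    refine h4.congr (Filter.Eventually.of_forall fun τ => ?_)
    simp only [Pi.sub_apply, add_sub_cancel_left]
    field_simp
  refine ⟨?_, hU, ?_⟩
  · refine ((h1.congr hD).const_mul ((T - s) * (T - t))⁻¹).congr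
      (Filter.Eventually.of_forall fun ω => ?_)
    simp only
    field_simp
  · rw [← integral_const_mul, ← integral_congr_ae hD, h3, setIntegral_congr_fun hmeas hE,
      integral_add (hHH.const_mul _) (hU.const_mul _), integral_const_mul, integral_const_mul]

theorem IsParticleSystem.memLp_error (h : IsParticleSystem P P' lam Y ξ Yp)
    (hl : 0 < lam) (hB : MeasurableSet B) (hB' : volume B ≠ ∞) (hB0 : volume B ≠ 0)
    (hN : AEMeasurable (fun p : ℝ × Ω => N B ξ Yp p.1.toNNReal p.2) (volume.prod P))
    (hs : IsStrictlyStationary P (N B ξ Yp)) {t T : ℝ} (ht : 0 ≤ t) (htT : t < T) :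
    MemLp (fun ω => Rhat (N B ξ Yp) (rho lam B) T t ω - R P (N B ξ Yp) t) 2 P := by
  have hpos : 0 < T - t := sub_pos.2 htT
  have : IsFiniteMeasure (volume.restrict (Set.Icc 0 (T - t))) := ⟨by simp⟩
  have h1 := ((h.memLp_empIntegrand_sub hl hB hB' hB0 hN t (R P (N B ξ Yp) t)
    (A := Set.Icc 0 (T - t)) (by simp)).integrable one_le_two).integral_prod_right
  refine (memLp_two_iff_integrable_sq ?_).2 ?_
  · refine (h1.aestronglyMeasurable.const_mul (T - t)⁻¹).congr ?_
    filter_upwards [h.Rhat_sub_R hl hB hB' hB0 hN htT] with ω hω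
    rw [← hω.2]
    field_simp
  · simp only [sq (Rhat _ _ _ _ _ - _)]
    exact (h.covariance_error hl hB hB' hB0 hN hs ht htT ht htT).1

/-! ### Iterated integrals and the bound for the mean squared error. -/

theorem setIntegral_Icc_prod_Icc {f : ℝ × ℝ → ℝ} {a b : ℝ} (ha : 0 ≤ a) (hb : 0 ≤ b)
    (hf : IntegrableOn f (Set.Icc 0 a ×ˢ Set.Icc 0 b) volume) :
    ∫ τ in Set.Icc 0 a ×ˢ Set.Icc 0 b, f τ =
      ∫ y in (0 : ℝ)..b, ∫ x in (0 : ℝ)..a, f (x, y) := by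
  rw [IntegrableOn, Measure.volume_eq_prod, ← Measure.prod_restrict] at hf
  rw [Measure.volume_eq_prod, ← Measure.prod_restrict, integral_prod_symm _ hf,
    intervalIntegral.integral_of_le hb, integral_Icc_eq_integral_Ioc]
  simp_rw [intervalIntegral.integral_of_le ha, integral_Icc_eq_integral_Ioc]

/-- A bound for the integral of `H` over the square in terms of its integral over an interval. -/
theorem integral_H_sub_add_le (hB : MeasurableSet B) (hB' : volume B ≠ ∞) (hB0 : volume B ≠ 0)
    (hY : ∀ t, Measurable (Y t)) (hY0 : ∀ᵐ ω ∂P', Y 0 ω = 0)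
    (hH : AEStronglyMeasurable (H P' B Y) volume) {t T c : ℝ} (ht : 0 ≤ t) (htT : t < T)
    (hc : 0 ≤ c) (hct : c ≤ t) :
    ∫ τ in Set.Icc 0 (T - t) ×ˢ Set.Icc 0 (T - t), H P' B Y (τ.1 - τ.2 + c) ≤
      (T - t) * (2 * ∫ y in (0 : ℝ)..T, H P' B Y y) := by
  have hpos : 0 < T - t := sub_pos.2 htT
  have hint := intervalIntegrable_H hB hB' hB0 hY hY0 hH
  have hfin : volume (Set.Icc 0 (T - t) ×ˢ Set.Icc 0 (T - t)) ≠ ∞ :=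
    (isCompact_Icc.prod isCompact_Icc).measure_ne_top
  have : IsFiniteMeasure (volume.restrict (Set.Icc 0 (T - t) ×ˢ Set.Icc 0 (T - t))) :=
    ⟨by simpa using hfin.lt_top⟩
  have hsymm : ∫ y in (-T)..T, H P' B Y y = 2 * ∫ y in (0 : ℝ)..T, H P' B Y y := by
    rw [← intervalIntegral.integral_add_adjacent_intervals (hint (-T) 0) (hint 0 T)]
    have := intervalIntegral.integral_comp_neg (a := 0) (b := T) (H P' B Y)
    simp only [H_neg, neg_zero] at this
    rw [← this, two_mul]
  have h1 : Integrable (fun τ : ℝ × ℝ => H P' B Y (τ.1 - τ.2 + c))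
      ((volume.restrict (Set.Icc 0 (T - t))).prod (volume.restrict (Set.Icc 0 (T - t)))) := by
    rw [Measure.prod_restrict, ← Measure.volume_eq_prod]
    exact integrable_H_comp hB hB' hB0 hY hY0 hH (quasiMeasurePreserving_sub_add c _)
  rw [Measure.volume_eq_prod, ← Measure.prod_restrict, integral_prod_symm _ h1]
  have h2 : ∀ y ∈ Set.Icc 0 (T - t), ∫ x in Set.Icc 0 (T - t), H P' B Y (x - y + c) ≤
      2 * ∫ y in (0 : ℝ)..T, H P' B Y y := by
    intro y hy
    rw [integral_Icc_eq_integral_Ioc, ← intervalIntegral.integral_of_le hpos.le, ← hsymm]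
    simp_rw [sub_add]
    -- The inner range becomes `[c - y, T - t - y + c]`. It lies in `[-T, T]` because `0 ≤ y ≤ T -
    -- t` and `0 ≤ c ≤ t`.
    rw [intervalIntegral.integral_comp_sub_right]
    refine intervalIntegral.integral_mono_interval ?_ ?_ ?_ ?_ (hint _ _)
    · linarith [hy.2]
    · linarith
    · linarith [hy.1]
    · exact Filter.Eventually.of_forall fun x => (H_mem_Icc hB hB' hB0 hY hY0 x).1
  refine (setIntegral_mono_on h1.integral_prod_right (integrable_const _) measurableSet_Icc
    h2).trans ?_
  simp [hpos.le]

/-- The mean squared error of the empirical covariance. -/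
theorem IsParticleSystem.mean_square_error_le (h : IsParticleSystem P P' lam Y ξ Yp)
    (hl : 0 < lam) (hB : MeasurableSet B) (hB' : volume B ≠ ∞) (hB0 : volume B ≠ 0)
    (hN : AEMeasurable (fun p : ℝ × Ω => N B ξ Yp p.1.toNNReal p.2) (volume.prod P))
    (hs : IsStrictlyStationary P (N B ξ Yp)) {t T : ℝ} (ht : 0 ≤ t) (htT : t < T) :
    ∫ ω, |Rhat (N B ξ Yp) (rho lam B) T t ω - R P (N B ξ Yp) t| ^ 2 ∂P ≤
      4 * (rho lam B ^ 2 + rho lam B) / (T - t) * ∫ y in (0 : ℝ)..T, H P' B Y y := by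
  have hpos : 0 < T - t := sub_pos.2 htT
  have hr : 0 ≤ rho lam B := rho_nonneg
  have hH := h.aestronglyMeasurable_H hl hB hB' hB0 hN hs
  have hH1 := H_mem_Icc hB hB' hB0 h.measurable_generic h.generic_zero
  obtain ⟨-, hU, heq⟩ := h.covariance_error hl hB hB' hB0 hN hs ht htT ht htT
  have hfin : volume (Set.Icc 0 (T - t) ×ˢ Set.Icc 0 (T - t)) ≠ ∞ :=
    (isCompact_Icc.prod isCompact_Icc).measure_ne_top
  have : IsFiniteMeasure (volume.restrict (Set.Icc 0 (T - t) ×ˢ Set.Icc 0 (T - t))) :=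
    ⟨by simpa using hfin.lt_top⟩
  have hHc (c : ℝ) := integrable_H_comp hB hB' hB0 h.measurable_generic h.generic_zero hH
    (quasiMeasurePreserving_sub_add c (Set.Icc 0 (T - t) ×ˢ Set.Icc 0 (T - t)))
  have hle (c : ℝ) (hc : 0 ≤ c) (hct : c ≤ t) := integral_H_sub_add_le hB hB' hB0
    h.measurable_generic h.generic_zero hH ht htT hc hct
  -- In each product one factor is bounded by one; the surviving factors have offsets `0` and `t`,
  -- the extreme admissible values of `c`.
  have b1 : ∫ τ in Set.Icc 0 (T - t) ×ˢ Set.Icc 0 (T - t),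
      (H P' B Y (τ.1 - τ.2) * H P' B Y (τ.1 - τ.2 + t - t) +
        H P' B Y (τ.1 - τ.2 - t) * H P' B Y (τ.1 - τ.2 + t)) ≤
      (T - t) * (2 * ∫ y in (0 : ℝ)..T, H P' B Y y) +
        (T - t) * (2 * ∫ y in (0 : ℝ)..T, H P' B Y y) := by
    refine le_trans ?_ (add_le_add (hle 0 le_rfl ht) (hle t ht le_rfl))
    rw [← integral_add (hHc 0) (hHc t)]
    refine integral_mono (integrableOn_H_mul_H_add hB hB' hB0 h.measurable_generic h.generic_zero
      hH t t hfin) ((hHc 0).add (hHc t)) fun τ => ?_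
    simp only [add_sub_cancel_right, add_zero]
    exact add_le_add (mul_le_of_le_one_right (hH1 _).1 (hH1 _).2)
      (mul_le_of_le_one_left (hH1 _).1 (hH1 _).2)
  have b2 : ∫ τ in Set.Icc 0 (T - t) ×ˢ Set.Icc 0 (T - t),
      U P' B Y ![τ.1.toNNReal, (τ.1 + t).toNNReal, τ.2.toNNReal, (τ.2 + t).toNNReal] ≤
      (T - t) * (2 * ∫ y in (0 : ℝ)..T, H P' B Y y) := by
    refine le_trans ?_ (hle 0 le_rfl ht)
    refine setIntegral_mono_on hU (hHc 0) (measurableSet_Icc.prod measurableSet_Icc)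
      fun τ hτ => ?_
    have h1 := h.U_eq_H hl hB hB' hB0 hs τ.1.toNNReal τ.2.toNNReal
    rw [Real.coe_toNNReal _ hτ.1.1, Real.coe_toNNReal _ hτ.2.1] at h1
    rw [add_zero, ← h1]
    -- Only the times `τ₁` and `τ₂`, at positions 0 and 2, are kept.
    refine (U_le_U_comp hB hB' h.measurable_generic _ (![0, 2] : Fin 2 → Fin 4)).trans_eq ?_
    congr 1
    funext i
    fin_cases i <;> rfl
  have b3 := add_le_add (mul_le_mul_of_nonneg_left b1 (sq_nonneg (rho lam B)))
    (mul_le_mul_of_nonneg_left b2 hr)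
  rw [← heq] at b3
  simp only [sq_abs, sq (Rhat _ _ _ _ _ - _)]
  have hI : 0 ≤ ∫ y in (0 : ℝ)..T, H P' B Y y :=
    intervalIntegral.integral_nonneg (ht.trans htT.le) fun x _ => (hH1 x).1
  -- The bounds add up to the factor `4ρ² + 2ρ`; the slack needed to reach `4(ρ² + ρ)` is this
  -- nonnegative term.
  have hb := mul_nonneg (mul_nonneg hr hI) hpos.le
  rw [div_mul_eq_mul_div, le_div_iff₀ hpos]
  refine le_of_mul_le_mul_left ?_ hpos
  nlinarith

end Particles

end Smoluchowski

/-! ### Assembly of the theorem. -/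

theorem mainTheorem5 :
    ∃ C : ℝ, 0 < C ∧
    ∀ (d : ℕ) (Ω : Type*) [MeasurableSpace Ω] (Ω' : Type*) [MeasurableSpace Ω']
      (P : Measure Ω) [IsProbabilityMeasure P] (P' : Measure Ω') [IsProbabilityMeasure P']
      (lam : ℝ≥0) (B : Set (EuclideanSpace ℝ (Fin d)))
      (Y : ℝ≥0 → Ω' → EuclideanSpace ℝ (Fin d))
      (ξ : ℤ → Ω → EuclideanSpace ℝ (Fin d))
      (Yp : ℤ → ℝ≥0 → Ω → EuclideanSpace ℝ (Fin d)),
      0 < lam → IsCompact B → (interior B).Nonempty →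
      IsParticleSystem P P' lam Y ξ Yp →
      -- `N` is a measurable process, so that its time integrals make sense
      AEMeasurable (fun p : ℝ × Ω => N B ξ Yp p.1.toNNReal p.2) (volume.prod P) →
      IsStrictlyStationary P (N B ξ Yp) →
      ∀ T : ℝ, 0 < T →
        -- the integrals below are integrals of integrable functions
        IntervalIntegrable (H P' B Y) volume 0 T ∧
        (∀ t : ℝ, 0 ≤ t → t < T →
          (∀ᵐ ω ∂P, IntervalIntegrable (empIntegrand (N B ξ Yp) (rho lam B) t ω)
            volume 0 (T - t)) ∧
          MemLp (fun ω => Rhat (N B ξ Yp) (rho lam B) T t ω - R P (N B ξ Yp) t) 2 P) ∧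
        -- the covariance of the errors
        (∀ t s : ℝ, 0 ≤ t → t < T → 0 ≤ s → s < T →
          IntegrableOn (fun τ : ℝ × ℝ =>
              H P' B Y (τ.1 - τ.2) * H P' B Y (τ.1 - τ.2 + t - s) +
                H P' B Y (τ.1 - τ.2 - s) * H P' B Y (τ.1 - τ.2 + t))
            (Set.Icc 0 (T - t) ×ˢ Set.Icc 0 (T - s)) volume ∧
          IntegrableOn (fun τ : ℝ × ℝ =>
              U P' B Y ![τ.1.toNNReal, (τ.1 + t).toNNReal, τ.2.toNNReal, (τ.2 + s).toNNReal])
            (Set.Icc 0 (T - t) ×ˢ Set.Icc 0 (T - s)) volume ∧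
          (T - s) * (T - t) *
              ∫ ω, (Rhat (N B ξ Yp) (rho lam B) T t ω - R P (N B ξ Yp) t) *
                (Rhat (N B ξ Yp) (rho lam B) T s ω - R P (N B ξ Yp) s) ∂P =
            rho lam B ^ 2 * (∫ τ₂ in (0 : ℝ)..(T - s), ∫ τ₁ in (0 : ℝ)..(T - t),
              (H P' B Y (τ₁ - τ₂) * H P' B Y (τ₁ - τ₂ + t - s) +
                H P' B Y (τ₁ - τ₂ - s) * H P' B Y (τ₁ - τ₂ + t))) +
            rho lam B * (∫ τ₂ in (0 : ℝ)..(T - s), ∫ τ₁ in (0 : ℝ)..(T - t),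
              U P' B Y ![τ₁.toNNReal, (τ₁ + t).toNNReal, τ₂.toNNReal, (τ₂ + s).toNNReal])) ∧
        -- the mean squared error
        (∀ t : ℝ, 0 ≤ t → t < T →
          ∫ ω, |Rhat (N B ξ Yp) (rho lam B) T t ω - R P (N B ξ Yp) t| ^ 2 ∂P ≤
            C * (rho lam B ^ 2 + rho lam B) / (T - t) * ∫ y in (0 : ℝ)..T, H P' B Y y) := by
  refine ⟨4, by norm_num, ?_⟩
  intro d Ω _ Ω' _ P _ P' _ lam B Y ξ Yp hl hBc hBi h hN hs T _
  have hB := hBc.measurableSet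
  have hB' := hBc.measure_ne_top (μ := volume)
  have hB0 := (Measure.measure_pos_of_nonempty_interior volume hBi).ne'
  have hH := h.aestronglyMeasurable_H hl hB hB' hB0 hN hs
  refine ⟨intervalIntegrable_H hB hB' hB0 h.measurable_generic h.generic_zero hH 0 T,
    fun t ht htT => ⟨?_, h.memLp_error hl hB hB' hB0 hN hs ht htT⟩,
    fun t s ht htT hs0 hsT => ?_, fun t ht htT => h.mean_square_error_le hl hB hB' hB0 hN hs ht htT⟩
  · filter_upwards [h.Rhat_sub_R hl hB hB' hB0 hN htT] with ω hω using hω.1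
  · have hHH := integrableOn_H_mul_H_add hB hB' hB0 h.measurable_generic h.generic_zero hH t s
      (A := Set.Icc 0 (T - t) ×ˢ Set.Icc 0 (T - s))
      (isCompact_Icc.prod isCompact_Icc).measure_ne_top
    obtain ⟨-, hU, heq⟩ := h.covariance_error hl hB hB' hB0 hN hs ht htT hs0 hsT
    refine ⟨hHH, hU, ?_⟩
    have ht' := (sub_pos.2 htT).le
    have hs' := (sub_pos.2 hsT).le
    rw [heq, setIntegral_Icc_prod_Icc ht' hs' hHH, setIntegral_Icc_prod_Icc ht' hs' hU]
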